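/- Let $K=\mathbb{C}(x,y,z)$ with the derivations $\partial_x,\partial_y,\partial_z$, and let $\Omega=P\,dy\wedge dz+Q\,dz\wedge dx+R\,dx\wedge dy$ with $P,Q,R\in K$. A Liouvillian extension of $K$ is a differential extension field $L\supseteq K$ (with three commuting derivations extending those of $K$) that has the same constants as $K$ and is obtained by a finite tower $K=K_0\subset K_1\subset\dots\subset K_m=L$ with $K_{i+1}=K_i(t_i)$, where for each $i$ either $t_i\neq 0$ and $\partial t_i/t_i\in K_i$ for all three derivations $\partial$, or $\partial t_i\in K_i$ for all three derivations $\partial$, or $t_i$ is algebraic over $K_i$. A Liouvillian first integral of $\Omega$ is a non-constant element $\varphi$ of some Liouvillian extension of $K$ with $d\varphi\wedge\Omega=0$. Two such first integrals $\varphi,\psi$ in a common Liouvillian extension are independent if $d\varphi\wedge d\psi\neq 0$. Suppose that $\Omega$ admits a Liouvillian first integral, but not two independent Liouvillian first integrals. Then there exist 1-forms $\omega,\alpha$ with coefficients in $K$ such that $$\omega\neq 0,\qquad \omega\wedge\Omega=0,\qquad \alpha\wedge\omega=d\omega,\qquad d\alpha=0 .$$ That is, $\omega$ is Darboux integrable over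 $K$, and $\Omega$ has a first integral $\varphi=\int\omega/m$ for some Darboux function $m=e^{\int\alpha}$ over $K$: in some Liouvillian extension of $K$ there are $m\neq 0$ and a first integral $\varphi$ of $\Omega$ with $dm=m\,\alpha$ and $d\varphi=\omega/m$, where $m$ has the form $\exp(g/f)\prod_k p_k^{a_k}$ with $g,f,p_k\in\mathbb{C}[x,y,z]$, $f,p_k\neq 0$, and $a_k\in\mathbb{C}$ (finitely many $k$), in the sense that $dm=m\,\bigl(d(g/f)+\sum_k a_k\,dp_k/p_k\bigr)$. -/

import Mathlib

open scoped Matrix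

noncomputable section

namespace Liouvillian

/-! ### The rational function field in three variables and its partial derivatives -/

/-- The polynomial ring `ℂ[x, y, z]`, with `x = X 0`, `y = X 1`, `z = X 2`. -/
abbrev Poly : Type := MvPolynomial (Fin 3) ℂ

/-- The field `ℂ(x, y, z)` of rational functions. -/
abbrev RatFun3 : Type := FractionRing Poly

/-- The quotient rule does not depend on how a rational function is written as a fraction. -/
theorem quotientRule_congr (i : Fin 3) (a b s t : Poly) (hs : s ≠ 0) (ht : t ≠ 0)
    (h : a * t = b * s) :
    (algebraMap Poly RatFun3 (s * MvPolynomial.pderiv i a - a * MvPolynomial.pderiv i s)) /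
        (algebraMap Poly RatFun3 s) ^ 2 =
      (algebraMap Poly RatFun3 (t * MvPolynomial.pderiv i b - b * MvPolynomial.pderiv i t)) /
        (algebraMap Poly RatFun3 t) ^ 2 := by
  have hs' : algebraMap Poly RatFun3 s ≠ 0 := by simpa using hs
  have ht' : algebraMap Poly RatFun3 t ≠ 0 := by simpa using ht
  rw [div_eq_div_iff (pow_ne_zero 2 hs') (pow_ne_zero 2 ht')]
  rw [← map_pow, ← map_pow, ← map_mul, ← map_mul]
  congr 1
  have hd : a * MvPolynomial.pderiv i t + t * MvPolynomial.pderiv i a =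
      b * MvPolynomial.pderiv i s + s * MvPolynomial.pderiv i b := by
    have := congrArg (MvPolynomial.pderiv i) h
    simpa [Derivation.leibniz] using this
  linear_combination (s * t) * hd + (-(MvPolynomial.pderiv i t * s)
    - MvPolynomial.pderiv i s * t) * h

/-- The partial derivative of a rational function, by the quotient rule applied to a chosen
representation as a fraction. -/
def ratDerivFun (i : Fin 3) (r : RatFun3) : RatFun3 :=
  let a : Poly := (IsLocalization.sec (nonZeroDivisors Poly) r).1
  let s : Poly := (IsLocalization.sec (nonZeroDivisors Poly) r).2
  (algebraMap Poly RatFun3 (s * MvPolynomial.pderiv i a - a * MvPolynomial.pderiv i s)) /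
    (algebraMap Poly RatFun3 s) ^ 2

/-- The quotient rule `∂ᵢ(a / s) = (s ∂ᵢa - a ∂ᵢs) / s²`. -/
theorem ratDerivFun_div (i : Fin 3) (a s : Poly) (hs : s ≠ 0) :
    ratDerivFun i (algebraMap Poly RatFun3 a / algebraMap Poly RatFun3 s) =
      (algebraMap Poly RatFun3 (s * MvPolynomial.pderiv i a - a * MvPolynomial.pderiv i s)) /
        (algebraMap Poly RatFun3 s) ^ 2 := by
  have hs' : algebraMap Poly RatFun3 s ≠ 0 := by simpa using hs
  set r : RatFun3 := algebraMap Poly RatFun3 a / algebraMap Poly RatFun3 s with hr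
  have h0 : ((IsLocalization.sec (nonZeroDivisors Poly) r).2 : Poly) ≠ 0 :=
    nonZeroDivisors.ne_zero (IsLocalization.sec (nonZeroDivisors Poly) r).2.2
  have h1 := IsLocalization.sec_spec (nonZeroDivisors Poly) r
  refine quotientRule_congr i _ _ _ _ h0 hs ?_
  apply IsFractionRing.injective Poly RatFun3
  rw [map_mul, map_mul, ← h1, hr]
  field_simp

theorem exists_eq_div (r : RatFun3) : ∃ a s : Poly, s ≠ 0 ∧
    r = algebraMap Poly RatFun3 a / algebraMap Poly RatFun3 s := by
  obtain ⟨a, s, hs, h⟩ := IsFractionRing.div_surjective (A := Poly) r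
  exact ⟨a, s, nonZeroDivisors.ne_zero hs, h.symm⟩

/-- The partial derivative `∂/∂x`, `∂/∂y`, `∂/∂z` (for `i = 0, 1, 2`) on `ℂ(x, y, z)`. -/
def ratDeriv (i : Fin 3) : Derivation ℂ RatFun3 RatFun3 :=
  Derivation.mk'
    { toFun := ratDerivFun i
      map_add' := by
        intro r r'
        obtain ⟨a, s, hs, rfl⟩ := exists_eq_div r
        obtain ⟨b, t, ht, rfl⟩ := exists_eq_div r'
        have hs' : algebraMap Poly RatFun3 s ≠ 0 := by simpa using hs
        have ht' : algebraMap Poly RatFun3 t ≠ 0 := by simpa using ht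
        rw [div_add_div _ _ hs' ht', ← map_mul, ← map_mul, ← map_add, ← map_mul,
          ratDerivFun_div i _ _ (mul_ne_zero hs ht), ratDerivFun_div i _ _ hs,
          ratDerivFun_div i _ _ ht]
        simp only [Derivation.leibniz, map_add, map_mul, map_sub, smul_eq_mul]
        field_simp
        ring
      map_smul' := by
        intro c r
        obtain ⟨a, s, hs, rfl⟩ := exists_eq_div r
        have hc : c • (algebraMap Poly RatFun3 a / algebraMap Poly RatFun3 s) =
            algebraMap Poly RatFun3 (c • a) / algebraMap Poly RatFun3 s := by
          rw [Algebra.smul_def, Algebra.smul_def, map_mul, mul_div_assoc,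
            ← IsScalarTower.algebraMap_apply ℂ Poly RatFun3]
        rw [hc, ratDerivFun_div i _ _ hs, ratDerivFun_div i _ _ hs]
        have h2 : s * MvPolynomial.pderiv i (c • a) - c • a * MvPolynomial.pderiv i s =
            algebraMap ℂ Poly c * (s * MvPolynomial.pderiv i a - a * MvPolynomial.pderiv i s) := by
          rw [Derivation.map_smul, Algebra.smul_def, Algebra.smul_def]
          ring
        rw [h2, map_mul, ← IsScalarTower.algebraMap_apply ℂ Poly RatFun3, RingHom.id_apply,
          Algebra.smul_def, mul_div_assoc] }
    (by
      intro r r'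
      change ratDerivFun i (r * r') = r • ratDerivFun i r' + r' • ratDerivFun i r
      obtain ⟨a, s, hs, rfl⟩ := exists_eq_div r
      obtain ⟨b, t, ht, rfl⟩ := exists_eq_div r'
      have hs' : algebraMap Poly RatFun3 s ≠ 0 := by simpa using hs
      have ht' : algebraMap Poly RatFun3 t ≠ 0 := by simpa using ht
      rw [div_mul_div_comm, ← map_mul, ← map_mul,
        ratDerivFun_div i _ _ (mul_ne_zero hs ht), ratDerivFun_div i _ _ hs,
        ratDerivFun_div i _ _ ht]
      simp only [Derivation.leibniz, map_add, map_mul, map_sub, smul_eq_mul]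
      field_simp
      ring)

/-- On polynomials, the partial derivative is the usual one. -/
theorem ratDeriv_algebraMap (i : Fin 3) (p : Poly) :
    ratDeriv i (algebraMap Poly RatFun3 p) =
      algebraMap Poly RatFun3 (MvPolynomial.pderiv i p) := by
  change ratDerivFun i _ = _
  have h := ratDerivFun_div i p 1 one_ne_zero
  rw [map_one, div_one] at h
  rw [h]
  simp

theorem ratDeriv_comm (i j : Fin 3) (r : RatFun3) :
    ratDeriv i (ratDeriv j r) = ratDeriv j (ratDeriv i r) := by
  have key : ∀ p : Poly, MvPolynomial.pderiv i (MvPolynomial.pderiv j p) =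
      MvPolynomial.pderiv j (MvPolynomial.pderiv i p) := by
    intro p
    have h0 : ⁅(MvPolynomial.pderiv i : Derivation ℂ Poly Poly),
        (MvPolynomial.pderiv j : Derivation ℂ Poly Poly)⁆ = 0 := by
      apply MvPolynomial.derivation_ext
      intro k
      simp only [Derivation.commutator_apply, MvPolynomial.pderiv_X, Pi.single_apply]
      split_ifs <;> simp
    have h1 := DFunLike.congr_fun h0 p
    rw [Derivation.commutator_apply, Derivation.zero_apply, sub_eq_zero] at h1
    exact h1
  obtain ⟨a, s, hs, rfl⟩ := exists_eq_div r
  simp only [Derivation.leibniz_div, Derivation.leibniz, ratDeriv_algebraMap, smul_eq_mul,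
    Derivation.leibniz_pow, map_sub, Derivation.leibniz_inv]
  rw [key a, key s]
  have hs' : algebraMap Poly RatFun3 s ≠ 0 := by simpa using hs
  have hu := mul_inv_cancel₀ hs'
  linear_combination (-2 * (algebraMap Poly RatFun3 s)⁻¹ ^ 2 *
    (algebraMap Poly RatFun3 (MvPolynomial.pderiv j a) *
        algebraMap Poly RatFun3 (MvPolynomial.pderiv i s) -
      algebraMap Poly RatFun3 (MvPolynomial.pderiv j s) *
        algebraMap Poly RatFun3 (MvPolynomial.pderiv i a))) * hu

/-! ### Differential fields and Liouvillian extensions -/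

/-- A field with three commuting derivations, `der 0`, `der 1`, `der 2`, which play the role of
`∂/∂x`, `∂/∂y`, `∂/∂z`. -/
class DiffField (L : Type*) [Field L] where
  der : Fin 3 → L →+ L
  der_mul : ∀ (i : Fin 3) (a b : L), der i (a * b) = der i a * b + a * der i b
  der_comm : ∀ (i j : Fin 3) (a : L), der i (der j a) = der j (der i a)

open DiffField

/-- `ℂ(x, y, z)` with its partial derivatives. -/
instance : DiffField RatFun3 where
  der i := (ratDeriv i : RatFun3 →+ RatFun3)
  der_mul i a b := by
    change ratDeriv i (a * b) = ratDeriv i a * b + a * ratDeriv i b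
    rw [Derivation.leibniz, smul_eq_mul, smul_eq_mul]
    ring
  der_comm i j a := ratDeriv_comm i j a

theorem der_ratFun3 (i : Fin 3) (r : RatFun3) : der i r = ratDeriv i r := rfl

/-- The subfield of constants of a differential field. -/
def constants (L : Type*) [Field L] [DiffField L] : Subfield L where
  carrier := {c | ∀ i, der i c = 0}
  mul_mem' := by
    intro a b ha hb i
    rw [der_mul, ha i, hb i, zero_mul, mul_zero, add_zero]
  one_mem' := by
    intro i
    have h := der_mul i (1 : L) 1
    rw [mul_one, mul_one, one_mul] at h
    exact left_eq_add.mp h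
  add_mem' := by
    intro a b ha hb i
    rw [map_add, ha i, hb i, add_zero]
  zero_mem' := fun i => map_zero (der i)
  neg_mem' := by
    intro a ha i
    rw [map_neg, ha i, neg_zero]
  inv_mem' := by
    intro a ha i
    rcases eq_or_ne a 0 with rfl | h0
    · rw [inv_zero, map_zero]
    · have h1 := der_mul i (1 : L) 1
      have h2 := der_mul i a a⁻¹
      rw [mul_one, mul_one, one_mul] at h1
      rw [mul_inv_cancel₀ h0, left_eq_add.mp h1, ha i, zero_mul, zero_add] at h2
      exact (mul_eq_zero.mp h2.symm).resolve_left h0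

/-- `L ⊇ K` is an extension of differential fields: the derivations of `L` restrict to those
of `K`. -/
class IsDiffExtension (K L : Type*) [Field K] [DiffField K] [Field L] [DiffField L]
    [Algebra K L] : Prop where
  der_algebraMap : ∀ (i : Fin 3) (a : K), der i (algebraMap K L a) = algebraMap K L (der i a)

/-- `E' = E(t)` where `t ≠ 0` is an exponential of an integral over `E`, or `t` is an integral
over `E`, or `t` is algebraic over `E`. -/
def IsLiouvillianStep {K L : Type*} [Field K] [Field L] [DiffField L] [Algebra K L]
    (E E' : IntermediateField K L) : Prop :=
  ∃ t : L, E' = (IntermediateField.adjoin E {t}).restrictScalars K ∧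
    ((t ≠ 0 ∧ ∀ i, der i t / t ∈ E) ∨ (∀ i, der i t ∈ E) ∨ IsAlgebraic E t)

/-- `L ⊇ K` is a Liouvillian extension of differential fields: it has no new constants, and it is
reached from `K` by a finite tower of Liouvillian steps. -/
structure IsLiouvillianExtension (K L : Type*) [Field K] [DiffField K] [Field L] [DiffField L]
    [Algebra K L] : Prop extends IsDiffExtension K L where
  constants_eq : (constants K).map (algebraMap K L) = constants L
  exists_tower : ∃ (m : ℕ) (F : ℕ → IntermediateField K L), F 0 = ⊥ ∧ F m = ⊤ ∧
    ∀ i < m, IsLiouvillianStep (F i) (F (i + 1))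

/-! ### Differential forms, in coordinates

The `dx`, `dy`, `dz` are placeholders: forms are given by their coefficients. -/

/-- The 1-form `a dx + b dy + c dz` is the triple `![a, b, c]`. -/
abbrev OneForm (L : Type*) := Fin 3 → L

/-- The 2-form `P dy ∧ dz + Q dz ∧ dx + R dx ∧ dy` is the triple `![P, Q, R]`. -/
abbrev TwoForm (L : Type*) := Fin 3 → L

section Forms

variable {L : Type*} [Field L]

/-- The wedge product of two 1-forms; in these coordinates it is the cross product. -/
def wedge (α β : OneForm L) : TwoForm L := α ⨯₃ β

/-- The wedge product of a 1-form and a 2-form; the result is the coefficient of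
`dx ∧ dy ∧ dz`. -/
def wedgeTwo (α : OneForm L) (Ω : TwoForm L) : L := α ⬝ᵥ Ω

variable [DiffField L]

/-- The differential `dφ` of a function. -/
def d (φ : L) : OneForm L := fun i => der i φ

/-- The exterior derivative `dω` of a 1-form. -/
def dOne (ω : OneForm L) : TwoForm L :=
  ![der 1 (ω 2) - der 2 (ω 1), der 2 (ω 0) - der 0 (ω 2), der 0 (ω 1) - der 1 (ω 0)]

end Forms

/-- A form over `K`, viewed over an extension field `L`. -/
def mapForm {K : Type*} (L : Type*) [Field K] [Field L] [Algebra K L] (ω : Fin 3 → K) :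
    Fin 3 → L :=
  fun i => algebraMap K L (ω i)

/-! ### First integrals and Darboux functions -/

/-- `φ ∈ L` is a first integral of the 2-form `Ω` over `ℂ(x, y, z)`: it is not constant and
`dφ ∧ Ω = 0`. -/
def IsFirstIntegral {L : Type*} [Field L] [DiffField L] [Algebra RatFun3 L]
    (Ω : TwoForm RatFun3) (φ : L) : Prop :=
  φ ∉ constants L ∧ wedgeTwo (d φ) (mapForm L Ω) = 0

/-- `Ω` has a first integral in some Liouvillian extension of `ℂ(x, y, z)`. -/
def HasLiouvillianFirstIntegral (Ω : TwoForm RatFun3) : Prop :=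
  ∃ (L : Type) (_ : Field L) (_ : DiffField L) (_ : Algebra RatFun3 L),
    IsLiouvillianExtension RatFun3 L ∧ ∃ φ : L, IsFirstIntegral Ω φ

/-- `Ω` has two first integrals in some Liouvillian extension of `ℂ(x, y, z)` that are
independent, that is, whose differentials have a nonzero wedge product. -/
def HasTwoIndependentLiouvillianFirstIntegrals (Ω : TwoForm RatFun3) : Prop :=
  ∃ (L : Type) (_ : Field L) (_ : DiffField L) (_ : Algebra RatFun3 L),
    IsLiouvillianExtension RatFun3 L ∧
      ∃ φ ψ : L, IsFirstIntegral Ω φ ∧ IsFirstIntegral Ω ψ ∧ wedge (d φ) (d ψ) ≠ 0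

/-- `m ∈ L` is a Darboux function `exp(g / f) ∏ pₖ ^ aₖ` (up to a nonzero constant factor), with
polynomials `g`, `f ≠ 0`, `pₖ ≠ 0` and complex exponents `aₖ`: that is, `m ≠ 0` and
`dm = m (d(g / f) + ∑ aₖ dpₖ / pₖ)`. -/
def IsDarbouxFunction {L : Type*} [Field L] [DiffField L] [Algebra RatFun3 L] (m : L) : Prop :=
  m ≠ 0 ∧ ∃ (g f : Poly) (N : ℕ) (p : Fin N → Poly) (a : Fin N → ℂ),
    f ≠ 0 ∧ (∀ k, p k ≠ 0) ∧
    d m = m • mapForm L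
      (d (algebraMap Poly RatFun3 g / algebraMap Poly RatFun3 f) +
        ∑ k, a k • (algebraMap Poly RatFun3 (p k))⁻¹ • d (algebraMap Poly RatFun3 (p k)))

end Liouvillian

end

open scoped Matrix
noncomputable section
namespace Liouvillian
open DiffField Polynomial IntermediateField

/-! A Liouvillian first integral `φ` yields the pair `(dφ, 0)`: a form `ω ≠ 0` annihilating `Ω`,
with `dω = α ∧ ω` and `α` closed. Such a pair (`IsDarbouxPair`) is pushed down the Liouvillian tower
containing `φ`, one generator at a time, until its coefficients are rational.

Transcendental generator `t` over `E`: embed `E(t)` in `E((s))`, with `s = t` for an exponential and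
`s = 1/t` for an integral, and compare lowest-order terms (`exists_isDarbouxPair_of_laurent`). Scale
`ω` by a power of `s` so that it starts in degree 0. If `α` has no pole, the constant terms of `ω`
and `α` form a pair over `E`. If `α` starts in degree `N < 0`, then `dω = α ∧ ω` forces the leading
coefficient of `α` to be parallel to that of `ω`. It therefore annihilates `Ω` too, and since `α` is
closed it is itself the first member of a pair.

Algebraic generator: this is where the absence of two independent first integrals enters. Any pair
over the algebraic closure of the top field can be integrated: `m = exp ∫α` and `ψ = ∫ω/m` exist in
a Liouvillian extension without new constants (`exists_liouvillian_integral`). As `ψ` is a first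
integral, `ω` is proportional to `dφ` (`wedge_d_eq_zero`). Hence all conjugates of `ω` are
proportional; once one coefficient is normalised to 1 they coincide, so `ω` is defined over `E`, and
`α` may be replaced by the average of its conjugates (`exists_isDarbouxPair_of_finite`).

Over `ℂ(x, y, z)`, a closed form is `dr + ∑ c dp/p` (`isLogExact_of_closed`): integrate one variable
at a time by Hermite reduction, the residues being constant because the form is closed. This makes
`m = exp ∫α` a Darboux function. -/

theorem aeval_derivative_minpoly_ne_zero {F L : Type*} [Field F] [CharZero F] [Field L]
    [Algebra F L] {x : L} (hx : IsAlgebraic F x) :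
    aeval x (derivative (minpoly F x)) ≠ 0 :=
  (minpoly.irreducible hx.isIntegral).separable.aeval_derivative_ne_zero (minpoly.aeval F x)

/-! ### Calculus rules in a differential field. -/

section Derivations

variable {F : Type*} [Field F] [DiffField F]

/-- The derivation `der i`, as a `ℤ`-linear derivation. -/
def derivation (i : Fin 3) : Derivation ℤ F F :=
  Derivation.mk' (der i : F →+ F).toIntLinearMap fun a b => by
    change der i (a * b) = a * der i b + b * der i a
    rw [der_mul]; ring

theorem derivation_apply (i : Fin 3) (a : F) : derivation i a = der i a := rfl

@[simp] theorem der_one (i : Fin 3) : der i (1 : F) = 0 := (derivation (F := F) i).map_one_eq_zero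

theorem der_pow (i : Fin 3) (a : F) (n : ℕ) : der i (a ^ n) = n * a ^ (n - 1) * der i a := by
  have h := (derivation i).leibniz_pow a n
  rw [derivation_apply, derivation_apply, nsmul_eq_mul, smul_eq_mul] at h
  rw [h, mul_assoc]

theorem der_natCast (i : Fin 3) (n : ℕ) : der i (n : F) = 0 := by
  have h := (derivation (F := F) i).map_natCast n
  rwa [derivation_apply] at h

theorem der_intCast (i : Fin 3) (n : ℤ) : der i (n : F) = 0 := by
  have h := (derivation (F := F) i).map_intCast n
  rwa [derivation_apply] at h

theorem der_inv (i : Fin 3) (a : F) : der i a⁻¹ = -(der i a) / a ^ 2 := by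
  have := (derivation i).leibniz_inv a
  rw [derivation_apply, derivation_apply, smul_eq_mul] at this
  rw [this, div_eq_mul_inv, inv_pow]; ring

theorem der_div (i : Fin 3) (a : F) {b : F} (hb : b ≠ 0) :
    der i (a / b) = (der i a * b - a * der i b) / b ^ 2 := by
  rw [div_eq_mul_inv, der_mul, der_inv]
  field_simp
  ring

theorem der_zpow (i : Fin 3) {a : F} (ha : a ≠ 0) (n : ℤ) :
    der i (a ^ n) / a ^ n = n * (der i a / a) := by
  have hs : ∀ n : ℕ, der i (a ^ n) / a ^ n = n * (der i a / a) := by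
    intro n
    rcases n with _ | n
    · simp
    · rw [der_pow, Nat.add_sub_cancel, pow_succ]
      field_simp
  obtain ⟨n, rfl | rfl⟩ := n.eq_nat_or_neg
  · simpa using hs n
  · rw [zpow_neg, zpow_natCast, der_inv]
    have := hs n
    have h0 : a ^ n ≠ 0 := pow_ne_zero n ha
    push_cast
    rw [neg_mul, ← this]
    field_simp

/-- A differential field with only one of its derivations. -/
abbrev differential (i : Fin 3) : Differential F := ⟨derivation i⟩

end Derivations

/-! ### Derivatives of polynomial expressions and of algebraic elements. -/

section Extensions

variable {F L : Type*} [Field F] [DiffField F] [Field L] [DiffField L] [Algebra F L]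
  [IsDiffExtension F L]

theorem der_algebraMap (i : Fin 3) (a : F) : der i (algebraMap F L a) = algebraMap F L (der i a) :=
  IsDiffExtension.der_algebraMap i a

/-- Differentiation of the coefficients of a polynomial. -/
def coeffDer (i : Fin 3) (p : F[X]) : F[X] :=
  letI := differential (F := F) i
  Differential.mapCoeffs p

@[simp] theorem coeff_coeffDer (i : Fin 3) (p : F[X]) (n : ℕ) :
    (coeffDer i p).coeff n = der i (p.coeff n) := rfl

theorem der_aeval (i : Fin 3) (x : L) (p : F[X]) :
    der i (aeval x p) = aeval x (coeffDer i p) + aeval x (derivative p) * der i x := by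
  let _ := differential (F := F) i
  let _ := differential (F := L) i
  have : DifferentialAlgebra F L := ⟨fun a => der_algebraMap i a⟩
  exact Differential.deriv_aeval_eq x p

/-- The derivatives of an algebraic element. -/
theorem der_eq_of_isAlgebraic [CharZero F] (i : Fin 3) {x : L} (hx : IsAlgebraic F x) :
    der i x = -aeval x (coeffDer i (minpoly F x)) / aeval x (derivative (minpoly F x)) := by
  have h := der_aeval i x (minpoly F x)
  rw [minpoly.aeval, map_zero] at h
  rw [eq_div_iff (aeval_derivative_minpoly_ne_zero hx)]
  linear_combination -h

/-- The minimal polynomial has coefficients killed by `der i`, so the formula for the derivative of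
an algebraic element gives zero. -/
theorem der_eq_zero_of_isAlgebraic [CharZero F] (i : Fin 3) {x : L} (hx : IsAlgebraic F x)
    (h : ∀ a : F, der i a = 0) : der i x = 0 := by
  rw [der_eq_of_isAlgebraic i hx]
  have : coeffDer i (minpoly F x) = 0 := by ext n; simp [h]
  simp [this]

end Extensions

/-! ### Extension of derivations to the algebraic closure. -/

section DifferentialClosure

variable {F : Type*} [Field F] [CharZero F]

open KaehlerDifferential TensorProduct in
/-- Derivations extend to algebraic extensions. -/
theorem exists_derivation_extension {L : Type*} [Field L] [Algebra F L] [Algebra.IsAlgebraic F L]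
    (D : Derivation ℤ F F) :
    ∃ D' : Derivation ℤ L L, ∀ a, D' (algebraMap F L a) = algebraMap F L (D a) := by
  -- Separable algebraic extensions are formally étale, so `Ω[L⁄ℤ]` is the base change of `Ω[F⁄ℤ]`,
  -- and a linear form on the latter extends to the former.
  have : Algebra.FormallyEtale F L := Algebra.FormallyEtale.of_isSeparable F L
  let D₁ : Derivation ℤ F L := (Algebra.linearMap F L).compDer D
  let f : L ⊗[F] Ω[F⁄ℤ] →ₗ[L] L := LinearMap.liftBaseChange L D₁.liftKaehlerDifferential
  let g : Ω[L⁄ℤ] →ₗ[L] L := f ∘ₗ (tensorKaehlerEquivOfFormallyEtale ℤ F L).symm.toLinearMap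
  refine ⟨g.compDer (KaehlerDifferential.D ℤ L), fun a => ?_⟩
  change f ((tensorKaehlerEquivOfFormallyEtale ℤ F L).symm
    (KaehlerDifferential.D ℤ L (algebraMap F L a))) = _
  rw [tensorKaehlerEquivOfFormallyEtale_symm_D_algebraMap]
  simp [f, D₁]

/-- The difference of the two derivations kills `F`, hence is `F`-linear, and an `F`-derivation
vanishes on every separable element. Applied to commutators, this shows that extended derivations
still commute. -/
theorem derivation_ext_of_isAlgebraic {L : Type*} [Field L] [Algebra F L]
    [Algebra.IsAlgebraic F L] {D₁ D₂ : Derivation ℤ L L}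
    (h : ∀ a, D₁ (algebraMap F L a) = D₂ (algebraMap F L a)) : D₁ = D₂ := by
  have h0 : ∀ a, (D₁ - D₂) (algebraMap F L a) = 0 := fun a => by simp [h a]
  ext x
  rw [← sub_eq_zero, ← Derivation.sub_apply]
  generalize D₁ - D₂ = E at h0
  let E' : Derivation F L L := Derivation.mk' 
    { toFun := E, map_add' := map_add E, map_smul' := fun a y => by
        simp [Algebra.smul_def, Derivation.leibniz, h0] } (by intro a b; simp)
  have h1 : E' (aeval x (minpoly F x)) = aeval x (derivative (minpoly F x)) • E' x :=
    Derivation.map_aeval _ _ _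
  rw [minpoly.aeval, map_zero, smul_eq_mul] at h1
  have hx := Algebra.IsAlgebraic.isAlgebraic (R := F) x
  exact (mul_eq_zero.mp h1.symm).resolve_left
    ((minpoly.irreducible hx.isIntegral).separable.aeval_derivative_ne_zero (minpoly.aeval F x))

variable [DiffField F]

/-- The derivations of a differential field extend to algebraic extensions. -/
theorem exists_diffField_of_isAlgebraic (L : Type*) [Field L] [Algebra F L]
    [Algebra.IsAlgebraic F L] : ∃ _ : DiffField L, IsDiffExtension F L := by
  choose D hD using fun i => exists_derivation_extension (L := L) (derivation (F := F) i)
  suffices h : (∀ i a b, D i (a * b) = D i a * b + a * D i b) ∧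
      ∀ i j a, D i (D j a) = D j (D i a) from
    letI I : DiffField L := { der := fun i => (D i : L →+ L), der_mul := h.1, der_comm := h.2 }
    ⟨I, ⟨hD⟩⟩
  refine ⟨fun i a b => ?_, fun i j a => ?_⟩
  · rw [Derivation.leibniz, smul_eq_mul, smul_eq_mul]
    ring
  · have h : ⁅D i, D j⁆ = 0 := by
      apply derivation_ext_of_isAlgebraic (F := F)
      intro b
      rw [Derivation.commutator_apply, Derivation.zero_apply, hD, hD, hD, hD, derivation_apply,
        derivation_apply, derivation_apply, derivation_apply, der_comm i j, sub_self]
    have h1 := DFunLike.congr_fun h a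
    rw [Derivation.commutator_apply, Derivation.zero_apply, sub_eq_zero] at h1
    exact h1

/-- The algebraic closure of a differential field is a differential field. -/
instance : DiffField (AlgebraicClosure F) :=
  (exists_diffField_of_isAlgebraic (F := F) (AlgebraicClosure F)).choose

instance : IsDiffExtension F (AlgebraicClosure F) :=
  (exists_diffField_of_isAlgebraic (F := F) (AlgebraicClosure F)).choose_spec

end DifferentialClosure

/-! ### Constants in algebraic extensions. -/

section Constants

variable {F L : Type*} [Field F] [DiffField F] [Field L] [DiffField L] [Algebra F L]
  [IsDiffExtension F L]

theorem mem_constants {c : F} : c ∈ constants F ↔ ∀ i, der i c = 0 := Iff.rfl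

theorem algebraMap_mem_constants_iff {c : F} : algebraMap F L c ∈ constants L ↔ c ∈ constants F := by
  simp only [mem_constants, der_algebraMap, map_eq_zero_iff _ (algebraMap F L).injective]

/-- An algebraic constant over a field with algebraically closed constants is a constant of that
field. -/
theorem exists_constant_of_isAlgebraic [CharZero F] [IsAlgClosed (constants F)] {c : L}
    (hc : c ∈ constants L) (halg : IsAlgebraic F c) : ∃ b ∈ constants F, algebraMap F L b = c := by
  have hmon := minpoly.monic halg.isIntegral
  -- Differentiating the coefficients kills the leading 1, so the result has lower degree; but it
  -- vanishes at `c`, because `c` is constant. By minimality it is zero.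
  have h0 : ∀ i, coeffDer i (minpoly F c) = 0 := by
    intro i
    by_contra hne
    have h := der_aeval i c (minpoly F c)
    rw [minpoly.aeval, map_zero, hc i, mul_zero, add_zero] at h
    have hdvd := minpoly.dvd F c h.symm
    have hdeg := Polynomial.natDegree_le_of_dvd hdvd hne
    have hlead : (coeffDer i (minpoly F c)).coeff (minpoly F c).natDegree = 0 := by
      rw [coeff_coeffDer, hmon.coeff_natDegree, der_one]
    have hle : (coeffDer i (minpoly F c)).natDegree ≤ (minpoly F c).natDegree := by
      rw [Polynomial.natDegree_le_iff_coeff_eq_zero]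
      intro N hN
      rw [coeff_coeffDer, Polynomial.coeff_eq_zero_of_natDegree_lt hN, map_zero]
    have heq := le_antisymm hle hdeg
    rw [← heq, Polynomial.coeff_natDegree, Polynomial.leadingCoeff_eq_zero] at hlead
    exact hne hlead
  -- The minimal polynomial has constant coefficients, so it has a constant root and, being
  -- irreducible, is linear.
  have hlift : minpoly F c ∈ Polynomial.lifts (constants F).subtype := by
    rw [Polynomial.lifts_iff_coeff_lifts]
    intro n
    refine ⟨⟨(minpoly F c).coeff n, fun i => ?_⟩, rfl⟩
    rw [← coeff_coeffDer, h0 i, coeff_zero]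
  obtain ⟨g, hg⟩ := (Polynomial.mem_lifts _).mp hlift
  have hgdeg : g.degree ≠ 0 := by
    rw [← Polynomial.degree_map g (constants F).subtype, hg]
    exact (minpoly.degree_pos halg.isIntegral).ne'
  obtain ⟨b, hb⟩ := IsAlgClosed.exists_root g hgdeg
  refine ⟨b, b.2, ?_⟩
  have hroot : (minpoly F c).eval (b : F) = 0 := by
    rw [← hg, Polynomial.eval_map]
    have := Polynomial.hom_eval₂ g (RingHom.id _) (constants F).subtype b
    rw [Polynomial.eval₂_id, hb.eq_zero, map_zero, RingHom.comp_id] at this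
    exact this.symm
  have hX : X - C (b : F) ∣ minpoly F c := Polynomial.dvd_iff_isRoot.mpr hroot
  have hassoc := (Polynomial.irreducible_X_sub_C (b : F)).associated_of_dvd
    (minpoly.irreducible halg.isIntegral) hX
  have h2 : aeval c (X - C (b : F)) = 0 := by
    obtain ⟨q, hq⟩ := hassoc.symm.dvd
    rw [hq, map_mul, minpoly.aeval, zero_mul]
  rw [map_sub, aeval_X, aeval_C, sub_eq_zero] at h2
  exact h2.symm

end Constants

/-! ### Forms by indices, and Darboux pairs. -/

section Forms

variable {F : Type*} [Field F]

/-- The antisymmetric index form treats all components alike and avoids the cyclic coordinates of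
the cross product in later computations. -/
theorem wedge_eq_iff (a b c e : Fin 3 → F) :
    wedge a b = wedge c e ↔ ∀ i j, a i * b j - a j * b i = c i * e j - c j * e i := by
  constructor
  · intro h i j
    have h0 := congrFun h 0
    have h1 := congrFun h 1
    have h2 := congrFun h 2
    simp only [wedge, cross_apply, Matrix.cons_val_zero, Matrix.cons_val_one,
      Matrix.cons_val] at h0 h1 h2
    fin_cases i <;> fin_cases j <;> simp only [Fin.zero_eta, Fin.mk_one, Fin.reduceFinMk] <;>
      first | ring1 | linear_combination h0 | linear_combination h1 | linear_combination h2 |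
        linear_combination -h0 | linear_combination -h1 | linear_combination -h2
  · intro h
    ext i
    fin_cases i <;> simp [wedge, cross_apply, h 1 2, h 2 0, h 0 1]

theorem wedge_eq_zero_iff (a b : Fin 3 → F) : wedge a b = 0 ↔ ∀ i j, a i * b j = a j * b i := by
  have := wedge_eq_iff a b 0 0
  simpa [wedge, sub_eq_zero] using this

theorem exists_smul_eq_of_wedge_eq_zero {a b : Fin 3 → F} (hb : b ≠ 0) (h : wedge a b = 0) :
    ∃ c : F, a = c • b := by
  rw [wedge_eq_zero_iff] at h
  obtain ⟨k, hk⟩ := Function.ne_iff.mp hb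
  rw [Pi.zero_apply] at hk
  refine ⟨a k / b k, funext fun i => ?_⟩
  rw [Pi.smul_apply, smul_eq_mul, div_mul_eq_mul_div, eq_div_iff hk]
  exact h i k

theorem wedgeTwo_smul (c : F) (a Ω : Fin 3 → F) : wedgeTwo (c • a) Ω = c * wedgeTwo a Ω := by
  simp [wedgeTwo]

variable [DiffField F]

theorem dOne_eq_wedge_iff (ω a b : Fin 3 → F) :
    dOne ω = wedge a b ↔ ∀ i j, der i (ω j) - der j (ω i) = a i * b j - a j * b i := by
  constructor
  · intro h i j
    have h0 := congrFun h 0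
    have h1 := congrFun h 1
    have h2 := congrFun h 2
    simp only [wedge, dOne, cross_apply, Matrix.cons_val_zero, Matrix.cons_val_one,
      Matrix.cons_val] at h0 h1 h2
    fin_cases i <;> fin_cases j <;> simp only [Fin.zero_eta, Fin.mk_one, Fin.reduceFinMk] <;>
      first | ring1 | linear_combination h0 | linear_combination h1 | linear_combination h2 |
        linear_combination -h0 | linear_combination -h1 | linear_combination -h2
  · intro h
    ext i
    fin_cases i <;> simp [wedge, dOne, cross_apply, h 1 2, h 2 0, h 0 1]

theorem dOne_eq_zero_iff (ω : Fin 3 → F) :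
    dOne ω = 0 ↔ ∀ i j, der i (ω j) = der j (ω i) := by
  have := dOne_eq_wedge_iff ω 0 0
  simpa [wedge, sub_eq_zero] using this

/-- A 1-form `ω ≠ 0` with `ω ∧ Ω = 0` and `dω = α ∧ ω` for the closed 1-form `α`, in terms of
coefficients. -/
structure IsDarbouxPair (Ω ω α : Fin 3 → F) : Prop where
  ne_zero : ω ≠ 0
  wedgeTwo_eq : wedgeTwo ω Ω = 0
  der_sub : ∀ i j, der i (ω j) - der j (ω i) = α i * ω j - α j * ω i
  closed : ∀ i j, der i (α j) = der j (α i)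

theorem der_logDer_comm (i j : Fin 3) (h : F) :
    der i (der j h / h) = der j (der i h / h) := by
  rcases eq_or_ne h 0 with rfl | h0
  · simp
  · rw [der_div _ _ h0, der_div _ _ h0, der_comm i j]
    ring

/-- Multiplication of `ω` by a function `h` changes `α` by `dh / h`. -/
theorem IsDarbouxPair.smul {Ω ω α : Fin 3 → F} (H : IsDarbouxPair Ω ω α) {h : F} (h0 : h ≠ 0) :
    IsDarbouxPair Ω (h • ω) (fun i => α i + der i h / h) where
  ne_zero := smul_ne_zero h0 H.ne_zero
  wedgeTwo_eq := by rw [wedgeTwo_smul, H.wedgeTwo_eq, mul_zero]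
  der_sub i j := by
    simp only [Pi.smul_apply, smul_eq_mul, der_mul]
    have := H.der_sub i j
    field_simp
    linear_combination h * this
  closed i j := by rw [map_add, map_add, H.closed i j, der_logDer_comm]

end Forms

/-! ### Laurent series as a differential field. -/

section Laurent

open HahnSeries

variable {F : Type*} [Field F]

/-- The map on Laurent series that acts on the coefficients. -/
def diagonalMap (τ : ℤ → F →+ F) : LaurentSeries F →+ LaurentSeries F where
  toFun f :=
    { coeff := fun j => τ j (f.coeff j)
      isPWO_support' := f.isPWO_support.mono fun j hj => by
        rw [Function.mem_support] at hj
        rw [HahnSeries.mem_support]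
        intro h
        rw [h, map_zero] at hj
        exact hj rfl }
  map_zero' := by ext j; simp
  map_add' f g := by ext j; simp

@[simp] theorem coeff_diagonalMap (τ : ℤ → F →+ F) (f : LaurentSeries F) (j : ℤ) :
    (diagonalMap τ f).coeff j = τ j (f.coeff j) := rfl

theorem support_diagonalMap_subset (τ : ℤ → F →+ F) (f : LaurentSeries F) :
    (diagonalMap τ f).support ⊆ f.support := by
  intro j hj
  rw [HahnSeries.mem_support] at hj ⊢
  intro h
  rw [coeff_diagonalMap, h, map_zero] at hj
  exact hj rfl

/-- The hypothesis is a graded Leibniz rule. It covers both ingredients of `laurentDer`: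
coefficientwise differentiation, and the Euler operator that multiplies the coefficient in degree
`j` by `j`. -/
theorem diagonalMap_mul (τ : ℤ → F →+ F)
    (hτ : ∀ a b x y, τ (a + b) (x * y) = τ a x * y + x * τ b y) (f g : LaurentSeries F) :
    diagonalMap τ (f * g) = diagonalMap τ f * g + f * diagonalMap τ g := by
  ext j
  rw [coeff_diagonalMap, HahnSeries.coeff_add, HahnSeries.coeff_mul,
    HahnSeries.coeff_mul_left' f.isPWO_support (support_diagonalMap_subset τ f),
    HahnSeries.coeff_mul_right' g.isPWO_support (support_diagonalMap_subset τ g), map_sum,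
    ← Finset.sum_add_distrib]
  refine Finset.sum_congr rfl fun p hp => ?_
  simp only [Finset.mem_antidiagonal] at hp
  rw [coeff_diagonalMap, coeff_diagonalMap, ← hp.2.2, hτ]

/-- A product of series that start in degrees `m` and `n` starts in degree `m + n`. -/
theorem coeff_mul_eq_zero {f g : LaurentSeries F} {m n j : ℤ} (hf : ∀ i < m, f.coeff i = 0)
    (hg : ∀ i < n, g.coeff i = 0) (hj : j < m + n) : (f * g).coeff j = 0 := by
  rw [HahnSeries.coeff_mul]
  refine Finset.sum_eq_zero fun p hp => ?_
  simp only [Finset.mem_antidiagonal] at hp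
  rcases lt_or_ge p.1 m with h | h
  · rw [hf _ h, zero_mul]
  · rw [hg p.2 (by omega), mul_zero]

/-- Only one pair of degrees contributes. The coefficients in degrees `m` and `n` may vanish, so the
lemma also serves when only lower bounds for the orders are known. -/
theorem coeff_mul_add {f g : LaurentSeries F} {m n : ℤ} (hf : ∀ i < m, f.coeff i = 0)
    (hg : ∀ i < n, g.coeff i = 0) : (f * g).coeff (m + n) = f.coeff m * g.coeff n := by
  rw [HahnSeries.coeff_mul]
  rw [Finset.sum_eq_single (m, n)]
  · intro p hp hne
    simp only [Finset.mem_antidiagonal] at hp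
    rcases lt_or_ge p.1 m with h | h
    · rw [hf _ h, zero_mul]
    · rw [hg p.2, mul_zero]
      by_contra hlt
      exact hne (Prod.ext (by omega) (by omega))
  · intro h
    simp only [Finset.mem_antidiagonal, HahnSeries.mem_support, and_true, not_and_or, ne_eq,
      not_not] at h
    rcases h with h | h <;> simp [h]

theorem algebraMap_laurent (c : F) : algebraMap F (LaurentSeries F) c = HahnSeries.C c := by
  simp [RingHom.algebraMap_toAlgebra]

/-- Multiplication of the `j`-th coefficient by `j`. -/
def eulerMap : LaurentSeries F →+ LaurentSeries F :=
  diagonalMap fun j => AddMonoidHom.mulLeft (j : F)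

theorem eulerMap_mul (f g : LaurentSeries F) :
    eulerMap (f * g) = eulerMap f * g + f * eulerMap g :=
  diagonalMap_mul _ (fun a b x y => by simp; ring) f g

variable [DiffField F]

/-- Differentiation of the coefficients of a Laurent series. -/
def coeffwiseDer (i : Fin 3) : LaurentSeries F →+ LaurentSeries F :=
  diagonalMap fun _ => der i

theorem coeffwiseDer_mul (i : Fin 3) (f g : LaurentSeries F) :
    coeffwiseDer i (f * g) = coeffwiseDer i f * g + f * coeffwiseDer i g :=
  diagonalMap_mul _ (fun _ _ x y => der_mul i x y) f g

/-- The derivation of `F((s))` that extends `der i` and maps `s` to `a i * s ^ (k + 1)`. -/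
def laurentDer (k : ℤ) (a : Fin 3 → F) (i : Fin 3) : LaurentSeries F →+ LaurentSeries F :=
  coeffwiseDer i + (AddMonoidHom.mulLeft (single k (a i))).comp eulerMap

theorem coeff_laurentDer (k : ℤ) (a : Fin 3 → F) (i : Fin 3) (f : LaurentSeries F) (j : ℤ) :
    (laurentDer k a i f).coeff j =
      der i (f.coeff j) + a i * (((j - k : ℤ) : F) * f.coeff (j - k)) := by
  change (coeffwiseDer i f + single k (a i) * eulerMap f).coeff j = _
  rw [HahnSeries.coeff_add, HahnSeries.coeff_single_mul]
  rfl

/-- `F((s))` as a differential field, with `ds = s ^ (k + 1) a` for a closed 1-form `a`. -/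
abbrev laurentDiffField (k : ℤ) (a : Fin 3 → F) (ha : ∀ i j, der i (a j) = der j (a i)) :
    DiffField (LaurentSeries F) where
  der := laurentDer k a
  der_mul i f g := by
    change coeffwiseDer i (f * g) + single k (a i) * eulerMap (f * g) =
      (coeffwiseDer i f + single k (a i) * eulerMap f) * g +
      f * (coeffwiseDer i g + single k (a i) * eulerMap g)
    rw [coeffwiseDer_mul, eulerMap_mul]
    ring
  der_comm i j f := by
    ext n
    simp only [coeff_laurentDer, map_add, der_mul, der_intCast]
    rw [ha i j, der_comm i j]
    ring

theorem isDiffExtension_laurent (k : ℤ) (a : Fin 3 → F)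
    (ha : ∀ i j, der i (a j) = der j (a i)) :
    letI := laurentDiffField k a ha
    IsDiffExtension F (LaurentSeries F) := by
  let _ := laurentDiffField k a ha
  refine ⟨fun i c => ?_⟩
  ext j
  rw [algebraMap_laurent, algebraMap_laurent]
  change (laurentDer k a i (HahnSeries.C c)).coeff j = (HahnSeries.C (der i c)).coeff j
  rw [coeff_laurentDer, HahnSeries.C_apply, HahnSeries.C_apply, HahnSeries.coeff_single,
    HahnSeries.coeff_single, HahnSeries.coeff_single]
  split_ifs with h1 h2 h2
  · simp [h2]
  · simp
  · simp [h2]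
  · simp

theorem laurentDer_single (k : ℤ) (a : Fin 3 → F) (i : Fin 3) (n : ℤ) :
    laurentDer k a i (single n (1 : F)) = single (n + k) (n * a i) := by
  ext j
  rw [coeff_laurentDer, HahnSeries.coeff_single, HahnSeries.coeff_single,
    HahnSeries.coeff_single]
  have h : (j - k = n) ↔ (j = n + k) := by omega
  by_cases h1 : j = n + k
  · subst h1
    simp [apply_ite (der i), mul_comm]
  · simp [h, h1, apply_ite (der i)]

end Laurent

/-! ### Constants of Laurent series fields. -/

section LaurentConstants

variable {F : Type*} [Field F]

theorem eq_algebraMap_of_coeff_eq_zero {c : LaurentSeries F} (h : ∀ j ≠ 0, c.coeff j = 0) :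
    c = algebraMap F (LaurentSeries F) (c.coeff 0) := by
  ext j
  rw [algebraMap_laurent, HahnSeries.C_apply, HahnSeries.coeff_single]
  split_ifs with hj
  · rw [hj]
  · exact h j hj

theorem coeff_algebraMap_zero (b : F) : (algebraMap F (LaurentSeries F) b).coeff 0 = b := by
  rw [algebraMap_laurent, HahnSeries.C_apply, HahnSeries.coeff_single_same]

theorem coeff_algebraMap_of_ne (b : F) {j : ℤ} (hj : j ≠ 0) :
    (algebraMap F (LaurentSeries F) b).coeff j = 0 := by
  rw [algebraMap_laurent, HahnSeries.C_apply, HahnSeries.coeff_single_of_ne hj]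

variable [DiffField F]

/-- Adjoining an exponential `s` of an integral of `a` gives no new constants unless some power
of `s` is already there. -/
theorem exists_eq_algebraMap_of_laurentDer_zero (a : Fin 3 → F)
    (hne : ∀ n : ℤ, n ≠ 0 → ∀ b : F, b ≠ 0 → ∃ i, der i b ≠ n * a i * b) {c : LaurentSeries F}
    (hc : ∀ i, laurentDer 0 a i c = 0) : ∃ b, algebraMap F (LaurentSeries F) b = c := by
  refine ⟨_, (eq_algebraMap_of_coeff_eq_zero fun j hj => ?_).symm⟩
  by_contra h0
  -- In each degree `j`, constancy of `c` reads `dcⱼ = -j a cⱼ`, which is excluded for `j ≠ 0` and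
  -- `cⱼ ≠ 0`.
  obtain ⟨i, hi⟩ := hne (-j) (neg_ne_zero.mpr hj) _ h0
  apply hi
  have h := congrArg (fun f => HahnSeries.coeff f j) (hc i)
  simp only [coeff_laurentDer, HahnSeries.coeff_zero, sub_zero] at h
  push_cast
  linear_combination h

variable [CharZero F]

/-- Adjoining an integral `s⁻¹` of `-a` gives no new constants unless it is already there. -/
theorem exists_eq_algebraMap_of_laurentDer_one (a : Fin 3 → F)
    (ha : ∀ i j, der i (a j) = der j (a i))
    (hne : ∀ b : F, ∃ i, der i b ≠ a i) {c : LaurentSeries F}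
    (hc : ∀ i, laurentDer 1 a i c = 0) : ∃ b, algebraMap F (LaurentSeries F) b = c := by
  have key : ∀ f : LaurentSeries F, (∀ i, laurentDer 1 a i f = 0) → f ≠ 0 →
      f.order = 0 ∧ ∀ i, der i (f.coeff 0) = 0 := by
    intro f hf hf0
    set N := f.order with hN
    have hNc : f.coeff N ≠ 0 := HahnSeries.coeff_order_eq_zero.not.mpr hf0
    have hlt : f.coeff (N - 1) = 0 := HahnSeries.coeff_eq_zero_of_lt_order (by omega)
    have h1 : ∀ i, der i (f.coeff N) = 0 := by
      intro i
      have h := congrArg (fun g => HahnSeries.coeff g N) (hf i)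
      simpa only [coeff_laurentDer, HahnSeries.coeff_zero, hlt, mul_zero, add_zero] using h
    have hN0 : N = 0 := by
      by_contra hne0
      have hNF : (N : F) ≠ 0 := by exact_mod_cast hne0
      -- Degree `N + 1` of `df = 0` reads `df_{N+1} + N a f_N = 0` with `f_N` constant; for `N ≠ 0`
      -- this would make `a` the differential of the witness.
      obtain ⟨i, hi⟩ := hne (-(f.coeff (N + 1)) / (N * f.coeff N))
      apply hi
      have h := congrArg (fun g => HahnSeries.coeff g (N + 1)) (hf i)
      simp only [coeff_laurentDer, HahnSeries.coeff_zero, add_sub_cancel_right] at h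
      have hD : der i (f.coeff (N + 1)) = -(a i * (N * f.coeff N)) := by linear_combination h
      rw [der_div _ _ (mul_ne_zero hNF hNc), der_mul, der_intCast, h1, map_neg, hD]
      field_simp
      ring
    exact ⟨hN0, by rw [← hN0]; exact h1⟩
  rcases eq_or_ne c 0 with rfl | hc0
  · exact ⟨0, map_zero _⟩
  have hder := (key c hc hc0).2
  refine ⟨c.coeff 0, ?_⟩
  by_contra hcc
  -- The difference is again constant, so by `key` it would have order 0 if nonzero, yet its term of
  -- degree 0 has been removed.
  have hsub : c - algebraMap F (LaurentSeries F) (c.coeff 0) ≠ 0 :=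
    sub_ne_zero.mpr (Ne.symm hcc)
  have hd : ∀ i, laurentDer 1 a i (c - algebraMap F (LaurentSeries F) (c.coeff 0)) = 0 := by
    intro i
    rw [map_sub, hc i]
    have := (isDiffExtension_laurent 1 a ha).der_algebraMap i (c.coeff 0)
    rw [hder i, map_zero] at this
    exact (congrArg (fun x => 0 - x) this).trans (sub_zero 0)
  have h2 := (key _ hd hsub).1
  have h3 : (c - algebraMap F (LaurentSeries F) (c.coeff 0)).coeff 0 ≠ 0 := by
    have h4 := HahnSeries.coeff_order_eq_zero.not.mpr hsub
    rwa [h2] at h4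
  rw [HahnSeries.coeff_sub, coeff_algebraMap_zero, sub_self] at h3
  exact h3 rfl

/-- A series all of whose terms differentiate to multiples of themselves is a scalar. -/
theorem exists_eq_algebraMap_of_der_eq_zero (a : Fin 3 → F) (i : Fin 3) (hai : a i ≠ 0)
    (hi : ∀ b : F, der i b = 0) {c : LaurentSeries F} (hc : laurentDer 1 a i c = 0) :
    ∃ b, algebraMap F (LaurentSeries F) b = c := by
  refine ⟨_, (eq_algebraMap_of_coeff_eq_zero fun j hj => ?_).symm⟩
  have h := congrArg (fun f => HahnSeries.coeff f (j + 1)) hc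
  simp only [coeff_laurentDer, HahnSeries.coeff_zero, add_sub_cancel_right, hi, zero_add] at h
  have hj' : (j : F) ≠ 0 := by exact_mod_cast hj
  simpa [hai, hj'] using h

end LaurentConstants

/-! ### Adjoining exponentials and integrals without new constants. -/

section Adjunction

variable {F : Type} [Field F] [CharZero F] [DiffField F]

/-- An exponential of an integral of a closed 1-form can be adjoined without new constants. -/
theorem exists_extension_exponential [IsAlgClosed F] (a : Fin 3 → F)
    (ha : ∀ i j, der i (a j) = der j (a i)) :
    ∃ (L : Type) (_ : Field L) (_ : DiffField L) (_ : Algebra F L), IsDiffExtension F L ∧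
      (∀ c ∈ constants L, ∃ b, algebraMap F L b = c) ∧
      ∃ m : L, m ≠ 0 ∧ ∀ i, der i m = algebraMap F L (a i) * m := by
  by_cases hm : ∃ m : F, m ≠ 0 ∧ ∀ i, der i m = a i * m
  · exact ⟨F, inferInstance, inferInstance, inferInstance, ⟨fun _ _ => rfl⟩, fun c _ => ⟨c, rfl⟩,
      hm⟩
  · have hne : ∀ n : ℤ, n ≠ 0 → ∀ b : F, b ≠ 0 → ∃ i, der i b ≠ n * a i * b := by
      intro n hn b hb
      by_contra! hcon
      -- If `db = n a b`, an `n`-th root of `b` has logarithmic differential `a`, so the exponential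
      -- would already lie in `F`. Algebraic closedness supplies the root, also for negative `n`.
      obtain ⟨m, hm'⟩ : ∃ m : F, m ^ n = b := by
        have hpos : 0 < n.natAbs := Int.natAbs_pos.mpr hn
        rcases Int.natAbs_eq n with h | h
        · obtain ⟨m, hm'⟩ := IsAlgClosed.exists_pow_nat_eq b hpos
          exact ⟨m, by rw [h, zpow_natCast, hm']⟩
        · obtain ⟨m, hm'⟩ := IsAlgClosed.exists_pow_nat_eq b⁻¹ hpos
          exact ⟨m, by rw [h, zpow_neg, zpow_natCast, hm', inv_inv]⟩
      have hm0 : m ≠ 0 := by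
        rintro rfl
        rw [zero_zpow n hn] at hm'
        exact hb hm'.symm
      refine hm ⟨m, hm0, fun i => ?_⟩
      have h := der_zpow i hm0 n
      rw [hm', hcon i, mul_div_assoc, div_self hb, mul_one] at h
      have hnF : (n : F) ≠ 0 := by exact_mod_cast hn
      rw [mul_left_cancel₀ hnF h, div_mul_cancel₀ _ hm0]
    refine ⟨LaurentSeries F, inferInstance, laurentDiffField 0 a ha, inferInstance,
      isDiffExtension_laurent 0 a ha,
      fun c hc => exists_eq_algebraMap_of_laurentDer_zero a hne hc, HahnSeries.single 1 1, ?_, ?_⟩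
    · exact HahnSeries.single_ne_zero one_ne_zero
    · intro i
      refine (laurentDer_single 0 a i 1).trans ?_
      rw [algebraMap_laurent, HahnSeries.C_apply, HahnSeries.single_mul_single]
      simp

/-- An integral of a closed 1-form can be adjoined without new constants. -/
theorem exists_extension_integral (a : Fin 3 → F)
    (ha : ∀ i j, der i (a j) = der j (a i)) :
    ∃ (L : Type) (_ : Field L) (_ : DiffField L) (_ : Algebra F L), IsDiffExtension F L ∧
      (∀ c ∈ constants L, ∃ b, algebraMap F L b = c) ∧
      ∃ t : L, ∀ i, der i t = algebraMap F L (a i) := by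
  by_cases hm : ∃ t : F, ∀ i, der i t = a i
  · exact ⟨F, inferInstance, inferInstance, inferInstance, ⟨fun _ _ => rfl⟩, fun c _ => ⟨c, rfl⟩,
      hm⟩
  · push Not at hm
    -- Here `ds = s² a`, so `-s⁻¹` has differential `a`.
    refine ⟨LaurentSeries F, inferInstance, laurentDiffField 1 a ha, inferInstance,
      isDiffExtension_laurent 1 a ha,
      fun c hc => exists_eq_algebraMap_of_laurentDer_one a ha hm hc,
      -HahnSeries.single (-1) 1, ?_⟩
    intro i
    refine (map_neg (laurentDer 1 a i) _).trans ?_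
    rw [laurentDer_single, algebraMap_laurent, HahnSeries.C_apply]
    ext j
    simp [HahnSeries.coeff_single]

end Adjunction

/-! ### Differential embeddings of simple extensions. -/

section AdjoinHom

variable {E L T : Type*} [Field E] [Field L] [Field T] [Algebra E L] [Algebra E T]

/-- Transcendental elements generate isomorphic extensions. -/
theorem exists_adjoin_hom {t : L} (ht : Transcendental E t) {τ : T} (hτ : Transcendental E τ) :
    ∃ ι : E⟮t⟯ →ₐ[E] T, ι (AdjoinSimple.gen E t) = τ := by
  refine ⟨(val E⟮τ⟯).comp ((RatFunc.algEquivOfTranscendental t ht).symm.trans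
    (RatFunc.algEquivOfTranscendental τ hτ) : E⟮t⟯ →ₐ[E] E⟮τ⟯), ?_⟩
  have h1 : (RatFunc.algEquivOfTranscendental t ht).symm (AdjoinSimple.gen E t) = RatFunc.X := by
    rw [AlgEquiv.symm_apply_eq]
    apply Subtype.ext
    rw [← RatFunc.algebraMap_X, RatFunc.algEquivOfTranscendental_algebraMap]
    simp
  rw [AlgHom.comp_apply]
  change val E⟮τ⟯ (RatFunc.algEquivOfTranscendental τ hτ
    ((RatFunc.algEquivOfTranscendental t ht).symm (AdjoinSimple.gen E t))) = τ
  rw [h1, ← RatFunc.algebraMap_X,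
    RatFunc.algEquivOfTranscendental_algebraMap]
  simp

variable [DiffField E] [DiffField L] [DiffField T]

/-- An intermediate field that is closed under the derivations is a differential field. -/
abbrev subDiffField (S : IntermediateField E L) (hS : ∀ i, ∀ x ∈ S, der i x ∈ S) :
    DiffField S where
  der i :=
    { toFun := fun x => ⟨der i (x : L), hS i x x.2⟩
      map_zero' := Subtype.ext (map_zero _)
      map_add' := fun _ _ => Subtype.ext (map_add _ _ _) }
  der_mul i a b := Subtype.ext (der_mul i (a : L) b)
  der_comm i j a := Subtype.ext (der_comm i j (a : L))

variable [IsDiffExtension E L] [IsDiffExtension E T]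

theorem der_mem_adjoin {s : Set L} (h : ∀ i, ∀ x ∈ s, der i x ∈ adjoin E s) (i : Fin 3) (x : L)
    (hx : x ∈ adjoin E s) : der i x ∈ adjoin E s := by
  induction hx using adjoin_induction with
  | mem x hx => exact h i x hx
  | algebraMap x => rw [der_algebraMap]; exact IntermediateField.algebraMap_mem _ _
  | add _ _ _ _ h1 h2 => rw [map_add]; exact add_mem h1 h2
  | inv _ hx h1 => rw [der_inv]; exact div_mem (neg_mem h1) (pow_mem hx 2)
  | mul _ _ hx hy h1 h2 => rw [der_mul]; exact add_mem (mul_mem h1 hy) (mul_mem hx h2)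

/-- A homomorphism on `E(t)` commutes with the derivations if it does so at `t`. -/
theorem adjoin_hom_der {t : L} (hS : ∀ i, ∀ x ∈ E⟮t⟯, der i x ∈ E⟮t⟯) (ι : E⟮t⟯ →ₐ[E] T)
    (i : Fin 3) (ht : ι ⟨der i t, hS i t (mem_adjoin_simple_self E t)⟩ =
      der i (ι (AdjoinSimple.gen E t))) (x : E⟮t⟯) :
    ι ⟨der i (x : L), hS i x x.2⟩ = der i (ι x) := by
  obtain ⟨x, hx⟩ := x
  induction hx using adjoin_induction with
  | mem x hx =>
    obtain rfl := Set.mem_singleton_iff.mp hx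
    exact ht
  | algebraMap x =>
    have h1 : (⟨algebraMap E L x, IntermediateField.algebraMap_mem _ _⟩ : E⟮t⟯) = algebraMap E E⟮t⟯ x := rfl
    have h2 : (⟨der i (algebraMap E L x), hS i _ (IntermediateField.algebraMap_mem _ _)⟩ : E⟮t⟯) =
        algebraMap E E⟮t⟯ (der i x) := Subtype.ext (der_algebraMap i x)
    rw [h1, AlgHom.commutes, der_algebraMap, ← AlgHom.commutes ι]
    exact congrArg ι h2
  | add x y hx hy h1 h2 =>
    have e1 : (⟨x + y, add_mem hx hy⟩ : E⟮t⟯) = ⟨x, hx⟩ + ⟨y, hy⟩ := rfl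
    have e2 : (⟨der i (x + y), hS i _ (add_mem hx hy)⟩ : E⟮t⟯) =
        ⟨der i x, hS i x hx⟩ + ⟨der i y, hS i y hy⟩ := Subtype.ext (map_add _ _ _)
    rw [e1, map_add, map_add, ← h1, ← h2, ← map_add]
    exact congrArg ι e2
  | inv x hx h1 =>
    have e1 : (⟨x⁻¹, inv_mem hx⟩ : E⟮t⟯) = (⟨x, hx⟩ : E⟮t⟯)⁻¹ := rfl
    have e2 : (⟨der i x⁻¹, hS i _ (inv_mem hx)⟩ : E⟮t⟯) =
        -⟨der i x, hS i x hx⟩ / ⟨x, hx⟩ ^ 2 := Subtype.ext (der_inv _ _)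
    rw [e1, map_inv₀, der_inv, ← h1, ← map_neg, ← map_pow, ← map_div₀]
    exact congrArg ι e2
  | mul x y hx hy h1 h2 =>
    have e1 : (⟨x * y, mul_mem hx hy⟩ : E⟮t⟯) = ⟨x, hx⟩ * ⟨y, hy⟩ := rfl
    have e2 : (⟨der i (x * y), hS i _ (mul_mem hx hy)⟩ : E⟮t⟯) =
        ⟨der i x, hS i x hx⟩ * ⟨y, hy⟩ + ⟨x, hx⟩ * ⟨der i y, hS i y hy⟩ :=
      Subtype.ext (der_mul _ _ _)
    rw [e1, map_mul, der_mul, ← h1, ← h2, ← map_mul, ← map_mul, ← map_add]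
    exact congrArg ι e2

end AdjoinHom

/-! ### Darboux pairs under differential homomorphisms. -/

section DarbouxPair

variable {F L : Type*} [Field F] [DiffField F] [Field L] [DiffField L]

/-- Homomorphisms of differential fields preserve Darboux pairs. -/
theorem IsDarbouxPair.map {Ω ω α : Fin 3 → F} (H : IsDarbouxPair Ω ω α) (f : F →+* L)
    (hf : ∀ i x, f (der i x) = der i (f x)) :
    IsDarbouxPair (fun i => f (Ω i)) (fun i => f (ω i)) (fun i => f (α i)) where
  ne_zero := by
    obtain ⟨k, hk⟩ := Function.ne_iff.mp H.ne_zero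
    exact Function.ne_iff.mpr ⟨k, (map_ne_zero f).mpr hk⟩
  wedgeTwo_eq := by
    have h := congrArg f H.wedgeTwo_eq
    simpa [wedgeTwo, dotProduct] using h
  der_sub i j := by
    have h := congrArg f (H.der_sub i j)
    simpa only [map_sub, map_mul, hf] using h
  closed i j := by rw [← hf, ← hf, H.closed]

/-- Field homomorphisms are injective, so every condition can be checked in the larger field. This
restricts a pair to a subfield that contains its coefficients. -/
theorem IsDarbouxPair.of_map {Ω ω α : Fin 3 → F} (f : F →+* L)
    (hf : ∀ i x, f (der i x) = der i (f x))
    (H : IsDarbouxPair (fun i => f (Ω i)) (fun i => f (ω i)) (fun i => f (α i))) :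
    IsDarbouxPair Ω ω α where
  ne_zero := by
    rintro rfl
    exact H.ne_zero (funext fun i => map_zero f)
  wedgeTwo_eq := by
    have h := H.wedgeTwo_eq
    apply f.injective
    simpa [wedgeTwo, dotProduct] using h
  der_sub i j := by
    have h := H.der_sub i j
    apply f.injective
    simpa only [map_sub, map_mul, hf] using h
  closed i j := by
    apply f.injective
    rw [hf, hf, H.closed]

end DarbouxPair

/-! ### Descent from Laurent series by leading coefficients. -/

section LaurentDescent

variable {F : Type*} [Field F]

/-- The common order of the three components; only some component need be nonzero there. -/
theorem exists_leading_coeff {v : Fin 3 → LaurentSeries F} (hv : v ≠ 0) :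
    ∃ r : ℤ, (∀ i, ∀ j < r, (v i).coeff j = 0) ∧ ∃ i, (v i).coeff r ≠ 0 := by
  have hne : ∃ j : ℤ, ∃ i, (v i).coeff j ≠ 0 := by
    by_contra! h
    exact hv (funext fun i => HahnSeries.ext (funext fun j => h j i))
  have hbdd : ∃ b : ℤ, ∀ z : ℤ, (∃ i, (v i).coeff z ≠ 0) → b ≤ z := by
    refine ⟨min (v 0).order (min (v 1).order (v 2).order), ?_⟩
    rintro z ⟨i, hi⟩
    have h := HahnSeries.order_le_of_coeff_ne_zero hi
    fin_cases i
    · exact (min_le_left _ _).trans h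
    · exact (min_le_right _ _).trans ((min_le_left _ _).trans h)
    · exact (min_le_right _ _).trans ((min_le_right _ _).trans h)
  obtain ⟨r, hr, hmin⟩ := Int.exists_least_of_bdd hbdd hne
  refine ⟨r, fun i j hj => ?_, hr⟩
  by_contra h
  exact absurd (hmin j ⟨i, h⟩) (not_le.mpr hj)

theorem coeff_wedgeTwo (n : ℤ) (v : Fin 3 → LaurentSeries F) (Ω : Fin 3 → F) :
    (wedgeTwo v (fun i => algebraMap F (LaurentSeries F) (Ω i))).coeff n =
      wedgeTwo (fun i => (v i).coeff n) Ω := by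
  simp only [wedgeTwo, dotProduct, Fin.sum_univ_three, HahnSeries.coeff_add, algebraMap_laurent,
    HahnSeries.C_apply, HahnSeries.coeff_mul_single_zero]

variable [DiffField F]

/-- The leading coefficients of a Darboux pair over `F((s))` give a Darboux pair over `F`. -/
theorem exists_isDarbouxPair_of_laurent {k : ℤ} (hk : k = 0 ∨ k = 1) (a : Fin 3 → F)
    (ha : ∀ i j, der i (a j) = der j (a i)) {Ω : Fin 3 → F} {ω α : Fin 3 → LaurentSeries F}
    (H : letI := laurentDiffField k a ha
      IsDarbouxPair (fun i => algebraMap F (LaurentSeries F) (Ω i)) ω α) :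
    ∃ ω' α' : Fin 3 → F, IsDarbouxPair Ω ω' α' := by
  let _ := laurentDiffField k a ha
  -- Multiplying `ω` by `s ^ (-r)` moves its order to 0 and changes `α` only by a logarithmic
  -- differential.
  wlog hlead : (∀ i, ∀ j < 0, (ω i).coeff j = 0) ∧ ∃ i, (ω i).coeff 0 ≠ 0 generalizing ω α
  · obtain ⟨r, hr, i, hi⟩ := exists_leading_coeff H.ne_zero
    have hs : HahnSeries.single (-r) (1 : F) ≠ 0 := HahnSeries.single_ne_zero one_ne_zero
    have hc : ∀ i j, ((HahnSeries.single (-r) (1 : F) • ω) i).coeff j = (ω i).coeff (j + r) := by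
      intro i j
      rw [Pi.smul_apply, smul_eq_mul, HahnSeries.coeff_single_mul, one_mul, sub_neg_eq_add]
    refine this (H.smul hs) ⟨fun i j hj => ?_, i, ?_⟩
    · rw [hc, hr]; omega
    · rwa [hc, zero_add]
  obtain ⟨hω, i₀, hi₀⟩ := hlead
  have hω0 : (fun i => (ω i).coeff 0) ≠ 0 := Function.ne_iff.mpr ⟨i₀, hi₀⟩
  have hannih : wedgeTwo (fun i => (ω i).coeff 0) Ω = 0 := by
    rw [← coeff_wedgeTwo, H.wedgeTwo_eq, HahnSeries.coeff_zero]
  have hder : ∀ i j : Fin 3, ∀ n : ℤ,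
      (der i ((ω j).coeff n) + a i * (((n - k : ℤ) : F) * (ω j).coeff (n - k))) -
        (der j ((ω i).coeff n) + a j * (((n - k : ℤ) : F) * (ω i).coeff (n - k))) =
      (α i * ω j).coeff n - (α j * ω i).coeff n := by
    intro i j n
    have h := congrArg (fun f => HahnSeries.coeff f n) (H.der_sub i j)
    simp only [HahnSeries.coeff_sub] at h
    rw [← h, ← coeff_laurentDer, ← coeff_laurentDer]
    rfl
  have hclosed : ∀ i j : Fin 3, ∀ n : ℤ,
      (der i ((α j).coeff n) + a i * (((n - k : ℤ) : F) * (α j).coeff (n - k))) =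
        (der j ((α i).coeff n) + a j * (((n - k : ℤ) : F) * (α i).coeff (n - k))) := by
    intro i j n
    rw [← coeff_laurentDer, ← coeff_laurentDer]
    exact congrArg (fun f => HahnSeries.coeff f n) (H.closed i j)
  by_cases hα : ∀ i, ∀ j < 0, (α i).coeff j = 0
  -- The contribution of `ds` in degree 0 vanishes: for `k = 0` through the factor `0 - k`, for `k =
  -- 1` because there is no term of degree `-1`.
  · have hz : ∀ v : Fin 3 → LaurentSeries F, (∀ i, ∀ j < 0, (v i).coeff j = 0) →
        ∀ i, (((0 - k : ℤ) : F) * (v i).coeff (0 - k)) = 0 := by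
      intro v hv i
      rcases hk with rfl | rfl
      · simp
      · rw [hv i _ (by norm_num), mul_zero]
    refine ⟨fun i => (ω i).coeff 0, fun i => (α i).coeff 0, hω0, hannih, fun i j => ?_,
      fun i j => ?_⟩
    · have h := hder i j 0
      have h1 := coeff_mul_add (hα i) (hω j)
      have h2 := coeff_mul_add (hα j) (hω i)
      rw [add_zero] at h1 h2
      rw [h1, h2, hz ω hω, hz ω hω] at h
      simpa using h
    · have h := hclosed i j 0
      rw [hz α hα, hz α hα] at h
      simpa using h
  · push Not at hα
    obtain ⟨i₁, j₁, hj₁, hi₁⟩ := hα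
    have hα0 : α ≠ 0 := by
      rintro rfl
      exact hi₁ rfl
    obtain ⟨N, hN, hNe⟩ := exists_leading_coeff hα0
    have hN0 : N < 0 := by
      by_contra hge
      exact hi₁ (hN i₁ j₁ (by omega))
    -- In degree `N < 0` the left side of `dω = α ∧ ω` has no term, so the leading coefficients of
    -- `α` and `ω` have zero wedge product.
    have hpar : wedge (fun i => (α i).coeff N) (fun i => (ω i).coeff 0) = 0 := by
      rw [wedge_eq_zero_iff]
      intro i j
      have h := hder i j N
      have h1 := coeff_mul_add (hN i) (hω j)
      have h2 := coeff_mul_add (hN j) (hω i)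
      rw [add_zero] at h1 h2
      have hk' : N - k < 0 := by omega
      rw [h1, h2, hω i _ hN0, hω j _ hN0, hω i _ hk', hω j _ hk'] at h
      simp only [map_zero, mul_zero, add_zero, sub_zero] at h
      exact (sub_eq_zero.mp h.symm)
    obtain ⟨c, hc⟩ := exists_smul_eq_of_wedge_eq_zero hω0 hpar
    -- Degree `N` of `dα = 0` reads `dα_N = -N a ∧ α_N` if `k = 0` and `dα_N = 0` if `k = 1`; this
    -- dictates the second form.
    refine ⟨fun i => (α i).coeff N, fun i => if k = 0 then -((N : F) * a i) else 0,
      Function.ne_iff.mpr hNe, ?_, fun i j => ?_, fun i j => ?_⟩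
    · rw [hc, wedgeTwo_smul, hannih, mul_zero]
    · have h := hclosed i j N
      rcases hk with rfl | rfl
      · rw [sub_zero] at h
        simp only [if_true]
        linear_combination h
      · rw [hN i (N - 1) (by omega), hN j (N - 1) (by omega)] at h
        simp only [one_ne_zero, if_false]
        linear_combination h
    · split_ifs
      · rw [map_neg, map_neg, der_mul, der_mul, der_intCast, der_intCast, ha i j]
        ring
      · rw [map_zero, map_zero]

end LaurentDescent

/-! ### Descent through a transcendental exponential or integral. -/

section TranscendentalDescent

theorem coeff_aeval_single {F : Type*} [Field F] {n : ℤ} (hn : n ≠ 0) (p : F[X]) (j : ℕ) :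
    (aeval (HahnSeries.single n (1 : F) : LaurentSeries F) p).coeff (j * n) = p.coeff j := by
  induction p using Polynomial.induction_on' with
  | add p q hp hq => rw [map_add, HahnSeries.coeff_add, hp, hq, coeff_add]
  | monomial m c =>
    rw [aeval_monomial, HahnSeries.single_pow, algebraMap_laurent, HahnSeries.C_apply,
      HahnSeries.single_mul_single, HahnSeries.coeff_single, coeff_monomial]
    simp [hn, eq_comm]

/-- Makes `t ↦ s ^ n` a well-defined embedding of `E(t)` into `E((s))`. -/
theorem transcendental_single {F : Type*} [Field F] {n : ℤ} (hn : n ≠ 0) :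
    Transcendental F (HahnSeries.single n (1 : F) : LaurentSeries F) := by
  rw [transcendental_iff]
  intro p hp
  ext j
  rw [← coeff_aeval_single hn, hp, HahnSeries.coeff_zero, coeff_zero]

variable {E L : Type*} [Field E] [DiffField E] [Field L] [DiffField L] [Algebra E L]
  [IsDiffExtension E L]

/-- A Darboux pair over `E(t)`, for an exponential of an integral or an integral `t` over `E` that
is transcendental, gives a Darboux pair over `E`. -/
theorem exists_isDarbouxPair_of_transcendental {t : L} (ht : Transcendental E t)
    (hstep : (∀ i, ∃ a : E, der i t = algebraMap E L a * t) ∨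
      ∀ i, ∃ a : E, der i t = algebraMap E L a)
    {Ω : Fin 3 → E} {ω α : Fin 3 → L} (hω : ∀ i, ω i ∈ E⟮t⟯) (hα : ∀ i, α i ∈ E⟮t⟯)
    (H : IsDarbouxPair (fun i => algebraMap E L (Ω i)) ω α) :
    ∃ ω' α' : Fin 3 → E, IsDarbouxPair Ω ω' α' := by
  have ht0 : t ≠ 0 := by
    rintro rfl
    exact ht isAlgebraic_zero
  have hS : ∀ i, ∀ x ∈ E⟮t⟯, der i x ∈ E⟮t⟯ := by
    refine der_mem_adjoin fun i x hx => ?_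
    obtain rfl := Set.mem_singleton_iff.mp hx
    rcases hstep with h | h
    · obtain ⟨a, ha⟩ := h i
      rw [ha]
      exact mul_mem (IntermediateField.algebraMap_mem _ _) (mem_adjoin_simple_self E x)
    · obtain ⟨a, ha⟩ := h i
      rw [ha]
      exact IntermediateField.algebraMap_mem _ _
  let _ := subDiffField E⟮t⟯ hS
  have HS : IsDarbouxPair (fun i => algebraMap E E⟮t⟯ (Ω i)) (fun i => ⟨ω i, hω i⟩)
      (fun i => ⟨α i, hα i⟩) :=
    IsDarbouxPair.of_map (algebraMap E⟮t⟯ L) (fun _ _ => rfl) H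
  -- The image of `t` is `s ^ n`. An exponential has `t = s` and `ds = s a`; an integral has `t =
  -- s⁻¹`, so `ds = -s² dt`, which explains the sign of `a`.
  obtain ⟨k, hk, a, ha, n, hn, hsin⟩ : ∃ k : ℤ, (k = 0 ∨ k = 1) ∧ ∃ a : Fin 3 → E,
      (∀ i j, der i (a j) = der j (a i)) ∧ ∃ n : ℤ, n ≠ 0 ∧
      ∀ ι : E⟮t⟯ →ₐ[E] LaurentSeries E, ι (AdjoinSimple.gen E t) = HahnSeries.single n (1 : E) →
        ∀ i, ι ⟨der i t, hS i t (mem_adjoin_simple_self E t)⟩ =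
          laurentDer k a i (HahnSeries.single n (1 : E)) := by
    rcases hstep with h | h
    · choose a ha using h
      refine ⟨0, Or.inl rfl, a, fun i j => ?_, 1, one_ne_zero, fun ι hι i => ?_⟩
      · have h := der_comm i j t
        rw [ha, ha, der_mul, der_mul, der_algebraMap, der_algebraMap, ha, ha] at h
        apply (algebraMap E L).injective
        apply mul_right_cancel₀ ht0
        linear_combination h
      · have e : (⟨der i t, hS i t (mem_adjoin_simple_self E t)⟩ : E⟮t⟯) =
            algebraMap E E⟮t⟯ (a i) * AdjoinSimple.gen E t := Subtype.ext (ha i)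
        rw [e, map_mul, AlgHom.commutes, hι, laurentDer_single, algebraMap_laurent,
          HahnSeries.C_apply, HahnSeries.single_mul_single]
        simp
    · choose a ha using h
      refine ⟨1, Or.inr rfl, -a, fun i j => ?_, -1, by norm_num, fun ι hι i => ?_⟩
      · have h := der_comm i j t
        rw [ha, ha, der_algebraMap, der_algebraMap] at h
        rw [Pi.neg_apply, Pi.neg_apply, map_neg, map_neg, (algebraMap E L).injective h]
      · have e : (⟨der i t, hS i t (mem_adjoin_simple_self E t)⟩ : E⟮t⟯) =
            algebraMap E E⟮t⟯ (a i) := Subtype.ext (ha i)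
        rw [e, AlgHom.commutes, laurentDer_single, algebraMap_laurent, HahnSeries.C_apply]
        simp
  obtain ⟨ι, hι⟩ := exists_adjoin_hom ht (transcendental_single (F := E) hn)
  let _ := laurentDiffField k a ha
  have := isDiffExtension_laurent k a ha
  refine exists_isDarbouxPair_of_laurent hk a ha (Ω := Ω) (ω := fun i => ι ⟨ω i, hω i⟩)
    (α := fun i => ι ⟨α i, hα i⟩) ?_
  have h := HS.map ι.toRingHom fun i x => adjoin_hom_der hS ι i (by rw [hι]; exact hsin ι hι i) x
  convert h using 2 with i
  · exact (ι.commutes (Ω i)).symm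
  · rfl
  · rfl

end TranscendentalDescent

/-! ### Descent through an algebraic extension by traces. -/

section AlgebraicDescent

/-- Embeddings of algebraic extensions commute with the derivations. -/
theorem algHom_der {E S M : Type*} [Field E] [DiffField E] [CharZero E] [Field S] [DiffField S]
    [Field M] [DiffField M] [Algebra E S] [Algebra E M] [IsDiffExtension E S]
    [IsDiffExtension E M] [Algebra.IsAlgebraic E S] (σ : S →ₐ[E] M) (i : Fin 3) (x : S) :
    σ (der i x) = der i (σ x) := by
  have hx := Algebra.IsAlgebraic.isAlgebraic (R := E) x
  rw [der_eq_of_isAlgebraic i hx, der_eq_of_isAlgebraic i (hx.algHom σ),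
    minpoly.algHom_eq σ σ.injective, map_div₀, map_neg, aeval_algHom_apply, aeval_algHom_apply]

/-- The trace is the sum over the embeddings into the algebraic closure, and each of these commutes
with the derivations. -/
theorem trace_der {E S : Type*} [Field E] [DiffField E] [CharZero E] [Field S] [DiffField S]
    [Algebra E S] [IsDiffExtension E S] [FiniteDimensional E S] (i : Fin 3) (x : S) :
    Algebra.trace E S (der i x) = der i (Algebra.trace E S x) := by
  apply (algebraMap E (AlgebraicClosure E)).injective
  rw [← der_algebraMap, trace_eq_sum_embeddings, trace_eq_sum_embeddings, map_sum]
  exact Finset.sum_congr rfl fun σ _ => algHom_der σ i x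

variable {E S M : Type*} [Field E] [DiffField E] [CharZero E] [Field S] [DiffField S]
  [Algebra E S] [IsDiffExtension E S] [FiniteDimensional E S] [Field M] [DiffField M]
  [Algebra E M] [IsDiffExtension E M] [IsAlgClosed M]

/-- A Darboux pair over a finite extension of `E` gives a Darboux pair over `E` if all conjugate
1-forms are proportional. -/
theorem exists_isDarbouxPair_of_finite {Ω : Fin 3 → E} {ω α : Fin 3 → S}
    (hM : ∀ ω₁ α₁ ω₂ α₂ : Fin 3 → M, IsDarbouxPair (fun i => algebraMap E M (Ω i)) ω₁ α₁ →
      IsDarbouxPair (fun i => algebraMap E M (Ω i)) ω₂ α₂ → wedge ω₁ ω₂ = 0)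
    (H : IsDarbouxPair (fun i => algebraMap E S (Ω i)) ω α) :
    ∃ ω' α' : Fin 3 → E, IsDarbouxPair Ω ω' α' := by
  -- Normalising one coefficient turns proportionality of the conjugates of `ω` into equality.
  wlog hk : ∃ k, ω k = 1 generalizing ω α
  · obtain ⟨k, hk⟩ := Function.ne_iff.mp H.ne_zero
    exact this (H.smul (inv_ne_zero hk)) ⟨k, inv_mul_cancel₀ hk⟩
  obtain ⟨k, hk⟩ := hk
  have hmap : ∀ σ : S →ₐ[E] M, IsDarbouxPair (fun i => algebraMap E M (Ω i)) (fun i => σ (ω i))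
      (fun i => σ (α i)) := by
    intro σ
    convert H.map σ.toRingHom (fun i x => algHom_der σ i x) using 2 with i
    · exact (σ.commutes (Ω i)).symm
    · rfl
    · rfl
  have heq : ∀ (σ τ : S →ₐ[E] M) (i : Fin 3), σ (ω i) = τ (ω i) := by
    intro σ τ i
    have h := (wedge_eq_zero_iff _ _).mp (hM _ _ _ _ (hmap σ) (hmap τ)) i k
    simpa [hk] using h
  set n : E := (Module.finrank E S : E) with hn
  have hn0 : n ≠ 0 := by
    rw [hn]
    exact_mod_cast Module.finrank_pos.ne'
  have htr : ∀ c : E, Algebra.trace E S (algebraMap E S c) = n * c := by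
    intro c
    rw [Algebra.trace_algebraMap, nsmul_eq_mul]
  -- The average of the conjugates of `ω i` equals `ω i`, since they all coincide; hence `ω` has
  -- coefficients in `E`.
  have hw : ∀ i, algebraMap E S (Algebra.trace E S (ω i) / n) = ω i := by
    intro i
    let σ : S →ₐ[E] M := IsAlgClosed.lift
    apply σ.toRingHom.injective
    change σ _ = σ _
    rw [AlgHom.commutes, map_div₀, trace_eq_sum_embeddings,
      Finset.sum_congr rfl fun τ _ => heq τ σ i, Finset.sum_const, Finset.card_univ,
      AlgHom.card, nsmul_eq_mul, hn, map_natCast, mul_div_cancel_left₀]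
    have := charZero_of_injective_algebraMap (algebraMap E M).injective
    exact Nat.cast_ne_zero.mpr (Module.finrank_pos (R := E) (M := S)).ne'
  have hsmul : ∀ x c, Algebra.trace E S (x * algebraMap E S c) = Algebra.trace E S x * c := by
    intro x c
    rw [mul_comm, ← Algebra.smul_def, map_smul, smul_eq_mul, mul_comm]
  -- With `ω` over `E`, the equation `dω = α ∧ ω` is `E`-linear in `α`, so it survives averaging
  -- `α`; closedness does so because the trace commutes with the derivations.
  refine ⟨fun i => Algebra.trace E S (ω i) / n, fun i => Algebra.trace E S (α i) / n, ?_, ?_,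
    fun i j => ?_, fun i j => ?_⟩
  · intro h0
    have h1 := hw k
    rw [show Algebra.trace E S (ω k) / n = 0 from congrFun h0 k, map_zero, hk] at h1
    exact zero_ne_one h1
  · apply (algebraMap E S).injective
    have h := H.wedgeTwo_eq
    simp only [wedgeTwo, dotProduct, map_sum, map_mul, map_zero, hw] at h ⊢
    exact h
  · have h := congrArg (Algebra.trace E S) (H.der_sub i j)
    rw [← hw i, ← hw j, der_algebraMap, der_algebraMap, ← map_sub, htr, map_sub, hsmul,
      hsmul] at h
    have h2 := mul_left_cancel₀ hn0 (h.trans (by field_simp :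
      _ = n * (Algebra.trace E S (α i) / n * (Algebra.trace E S (ω j) / n) -
        Algebra.trace E S (α j) / n * (Algebra.trace E S (ω i) / n))))
    exact h2
  · have hnd : ∀ i, der i n = 0 := fun i => der_natCast i _
    rw [der_div _ _ hn0, der_div _ _ hn0, hnd, hnd, ← trace_der, ← trace_der, H.closed,
      mul_zero, mul_zero]

end AlgebraicDescent

/-! ### Inductive form of Liouvillian towers. -/

section Reachable

variable {K L : Type*} [Field K] [Field L] [DiffField L] [Algebra K L]

/-- `E` is reached from `K` by a finite tower of Liouvillian steps inside `L`. -/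
inductive IsReachable : IntermediateField K L → Prop
  | bot : IsReachable ⊥
  | step {E E' : IntermediateField K L} : IsReachable E → IsLiouvillianStep E E' → IsReachable E'

/-- Joins of intermediate fields over `K` are preserved by images and restrictions, so in this form
steps are easily transported. -/
theorem isLiouvillianStep_iff {E E' : IntermediateField K L} :
    IsLiouvillianStep E E' ↔ ∃ t : L, E' = E ⊔ adjoin K {t} ∧
      ((t ≠ 0 ∧ ∀ i, der i t / t ∈ E) ∨ (∀ i, der i t ∈ E) ∨ IsAlgebraic E t) := by
  unfold IsLiouvillianStep
  simp only [restrictScalars_adjoin_eq_sup]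

theorem IsLiouvillianStep.le {E E' : IntermediateField K L} (h : IsLiouvillianStep E E') :
    E ≤ E' := by
  obtain ⟨t, rfl, -⟩ := isLiouvillianStep_iff.mp h
  exact le_sup_left

theorem IsReachable.exists_tower {E : IntermediateField K L} (h : IsReachable E) :
    ∃ (m : ℕ) (F : ℕ → IntermediateField K L), F 0 = ⊥ ∧ F m = E ∧
      ∀ i < m, IsLiouvillianStep (F i) (F (i + 1)) := by
  induction h with
  | bot => exact ⟨0, fun _ => ⊥, rfl, rfl, fun i hi => absurd hi (Nat.not_lt_zero i)⟩
  | @step E E' _ hstep ih =>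
    obtain ⟨m, F, h0, hm, hF⟩ := ih
    refine ⟨m + 1, fun i => if i ≤ m then F i else E', by simp [h0], by simp, fun i hi => ?_⟩
    rcases Nat.lt_succ_iff_lt_or_eq.mp hi with hlt | rfl
    · have h1 : i ≤ m := hlt.le
      have h2 : i + 1 ≤ m := hlt
      simpa only [if_pos h1, if_pos h2] using hF i hlt
    · simpa [hm] using hstep

theorem isReachable_of_tower {m : ℕ} {F : ℕ → IntermediateField K L} (h0 : F 0 = ⊥)
    (hF : ∀ i < m, IsLiouvillianStep (F i) (F (i + 1))) : IsReachable (F m) := by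
  have h : ∀ i ≤ m, IsReachable (F i) := by
    intro i
    induction i with
    | zero => intro _; rw [h0]; exact IsReachable.bot
    | succ i ih => intro hi; exact (ih (by omega)).step (hF i (by omega))
  exact h m le_rfl

theorem IsReachable.map {M : Type*} [Field M] [DiffField M] [Algebra K M] (f : L →ₐ[K] M)
    (hf : ∀ i x, f (der i x) = der i (f x)) {E : IntermediateField K L} (h : IsReachable E) :
    IsReachable (E.map f) := by
  induction h with
  | bot => rw [IntermediateField.map_bot]; exact IsReachable.bot
  | @step E E' _ hstep ih =>
    obtain ⟨t, rfl, ht⟩ := isLiouvillianStep_iff.mp hstep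
    refine ih.step (isLiouvillianStep_iff.mpr ⟨f t, ?_, ?_⟩)
    · rw [IntermediateField.map_sup, adjoin_map, Set.image_singleton]
    · rcases ht with ⟨h0, h1⟩ | h1 | h1
      · refine Or.inl ⟨(_root_.map_ne_zero f).mpr h0, fun i => ?_⟩
        rw [← hf, ← map_div₀]
        exact ⟨_, h1 i, rfl⟩
      · refine Or.inr (Or.inl fun i => ?_)
        rw [← hf]
        exact ⟨_, h1 i, rfl⟩
      · refine Or.inr (Or.inr ?_)
        exact h1.ringHom_of_comp_eq (E.equivMap f).toRingEquiv.toRingHom f.toRingHom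
          (E.equivMap f).injective rfl

/-- Reachability inside of a larger reachable field. -/
theorem IsReachable.restrict {E₀ E : IntermediateField K L} (hE₀ : ∀ i, ∀ x ∈ E₀, der i x ∈ E₀)
    (h : IsReachable E) (hle : E ≤ E₀) :
    letI := subDiffField E₀ hE₀
    IsReachable (IntermediateField.restrict hle) := by
  let _ := subDiffField E₀ hE₀
  change IsReachable (IntermediateField.restrict hle)
  induction h with
  | bot =>
    have : IntermediateField.restrict hle = ⊥ := by
      apply lift_injective
      rw [lift_restrict, lift_bot]
    rw [this]
    exact IsReachable.bot
  | @step E E' _ hstep ih =>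
    have hEE' := hstep.le
    obtain ⟨t, hE', ht⟩ := isLiouvillianStep_iff.mp hstep
    have htE : t ∈ E₀ := by
      apply hle
      rw [hE']
      exact (le_sup_right : adjoin K {t} ≤ E ⊔ adjoin K {t}) (mem_adjoin_simple_self K t)
    refine (ih (hEE'.trans hle)).step (isLiouvillianStep_iff.mpr ⟨⟨t, htE⟩, ?_, ?_⟩)
    · apply lift_injective
      rw [lift_restrict, lift_sup, lift_restrict, lift_adjoin_simple, hE']
    · rcases ht with ⟨h0, h1⟩ | h1 | h1
      · refine Or.inl ⟨fun h => h0 (congrArg Subtype.val h), fun i => ?_⟩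
        rw [mem_restrict]
        exact h1 i
      · refine Or.inr (Or.inl fun i => ?_)
        rw [mem_restrict]
        exact h1 i
      · refine Or.inr (Or.inr ?_)
        exact IsAlgebraic.of_ringHom_of_comp_eq (R := IntermediateField.restrict (hEE'.trans hle))
          (S := E) (A := E₀) (B := L)
          (restrictAlgEquiv (hEE'.trans hle)).symm.toRingEquiv.toRingHom E₀.val.toRingHom
          h1 (restrictAlgEquiv (hEE'.trans hle)).symm.surjective E₀.val.injective
          (by
            ext x
            obtain ⟨y, rfl⟩ := (restrictAlgEquiv (hEE'.trans hle)).surjective x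
            change ((restrictAlgEquiv (hEE'.trans hle)).symm
              (restrictAlgEquiv (hEE'.trans hle) y) : L) = y
            rw [AlgEquiv.symm_apply_apply])

theorem IsLiouvillianExtension.isReachable_top [DiffField K] (h : IsLiouvillianExtension K L) :
    IsReachable (⊤ : IntermediateField K L) := by
  obtain ⟨m, F, h0, hm, hF⟩ := h.exists_tower
  rw [← hm]
  exact isReachable_of_tower h0 hF

theorem IsReachable.adjoin_step {E : IntermediateField K L} (h : IsReachable E) (t : L)
    (ht : (t ≠ 0 ∧ ∀ i, der i t / t ∈ E) ∨ (∀ i, der i t ∈ E) ∨ IsAlgebraic E t) :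
    ∃ E', IsReachable E' ∧ E ≤ E' ∧ t ∈ E' :=
  ⟨E ⊔ adjoin K {t}, h.step (isLiouvillianStep_iff.mpr ⟨t, rfl, ht⟩), le_sup_left,
    (le_sup_right : adjoin K {t} ≤ E ⊔ adjoin K {t}) (mem_adjoin_simple_self K t)⟩

/-- An algebraic closure need not be a finite tower, but the finitely many coefficients of given
forms can be adjoined one by one. -/
theorem IsReachable.adjoin_finset {E : IntermediateField K L} (h : IsReachable E) (s : Finset L)
    (hs : ∀ t ∈ s, IsAlgebraic E t) : ∃ E', IsReachable E' ∧ E ≤ E' ∧ ∀ t ∈ s, t ∈ E' := by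
  classical
  induction s using Finset.induction_on with
  | empty => exact ⟨E, h, le_rfl, by simp⟩
  | insert t s _ ih =>
    obtain ⟨E₁, h1, hle1, hs1⟩ := ih fun t ht => hs t (Finset.mem_insert_of_mem ht)
    have halg : IsAlgebraic E₁ t :=
      (hs t (Finset.mem_insert_self t s)).ringHom_of_comp_eq (inclusion hle1).toRingHom
        (RingHom.id L) (inclusion hle1).injective rfl
    obtain ⟨E₂, h2, hle2, ht2⟩ := h1.adjoin_step t (Or.inr (Or.inr halg))
    refine ⟨E₂, h2, hle1.trans hle2, fun x hx => ?_⟩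
    rcases Finset.mem_insert.mp hx with rfl | hx
    · exact ht2
    · exact hle2 (hs1 x hx)

theorem isDiffExtension_subDiffField (E : IntermediateField K L)
    (hE : ∀ i, ∀ x ∈ E, der i x ∈ E) :
    letI := subDiffField E hE
    IsDiffExtension E L :=
  letI := subDiffField E hE
  ⟨fun _ _ => rfl⟩

variable [DiffField K] [IsDiffExtension K L]

theorem isDiffExtension_base_subDiffField (E : IntermediateField K L)
    (hE : ∀ i, ∀ x ∈ E, der i x ∈ E) :
    letI := subDiffField E hE
    IsDiffExtension K E :=
  letI := subDiffField E hE
  ⟨fun i a => Subtype.ext (der_algebraMap (L := L) i a)⟩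

/-- Each kind of generator has its derivatives in the field it generates; for an algebraic one this
follows from the formula through its minimal polynomial. -/
theorem IsReachable.der_mem [CharZero K] {E : IntermediateField K L} (h : IsReachable E) :
    ∀ i, ∀ x ∈ E, der i x ∈ E := by
  induction h with
  | bot =>
    rintro i x hx
    obtain ⟨a, rfl⟩ := mem_bot.mp hx
    rw [der_algebraMap]
    exact mem_bot.mpr ⟨_, rfl⟩
  | @step E E' _ hstep ih =>
    obtain ⟨t, rfl, ht⟩ := hstep
    let _ := subDiffField E ih
    have := isDiffExtension_subDiffField E ih
    intro i x hx
    refine der_mem_adjoin (E := E) (fun i x hx => ?_) i x hx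
    obtain rfl := Set.mem_singleton_iff.mp hx
    have hmem : ∀ y ∈ E, y ∈ adjoin E {x} := fun y hy =>
      IntermediateField.algebraMap_mem (adjoin E {x}) (⟨y, hy⟩ : E)
    rcases ht with ⟨h0, h1⟩ | h1 | h1
    · rw [← div_mul_cancel₀ (der i x) h0]
      exact mul_mem (hmem _ (h1 i)) (mem_adjoin_simple_self E x)
    · exact hmem _ (h1 i)
    · rw [der_eq_of_isAlgebraic i h1]
      exact (mem_adjoin_simple_iff E _).mpr ⟨_, _, by rw [← map_neg]⟩

/-- A reachable subfield of an extension without new constants is a Liouvillian extension. -/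
theorem IsReachable.isLiouvillianExtension [CharZero K]
    (hconst : ∀ c ∈ constants L, ∃ b ∈ constants K, algebraMap K L b = c)
    {E : IntermediateField K L} (h : IsReachable E) :
    letI := subDiffField E h.der_mem
    IsLiouvillianExtension K E := by
  let _ := subDiffField E h.der_mem
  have hext := isDiffExtension_base_subDiffField E h.der_mem
  refine { hext with constants_eq := ?_, exists_tower := ?_ }
  · ext c
    constructor
    · rintro ⟨b, hb, rfl⟩
      exact algebraMap_mem_constants_iff.mpr hb
    · intro hc
      have hcL : (c : L) ∈ constants L := fun i => congrArg Subtype.val (hc i)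
      obtain ⟨b, hb, hbc⟩ := hconst _ hcL
      exact ⟨b, hb, Subtype.ext hbc⟩
  · obtain ⟨m, F, h0, hm, hF⟩ := (h.restrict h.der_mem le_rfl).exists_tower
    refine ⟨m, F, h0, ?_, hF⟩
    rw [hm]
    apply lift_injective
    rw [lift_restrict, lift_top]

end Reachable

/-! ### Integrating a Darboux pair in a Liouvillian extension. -/

section Integrals

theorem isDiffExtension_trans (A B C : Type*) [Field A] [Field B] [Field C] [DiffField A]
    [DiffField B] [DiffField C] [Algebra A B] [Algebra B C] [Algebra A C] [IsScalarTower A B C]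
    [IsDiffExtension A B] [IsDiffExtension B C] : IsDiffExtension A C :=
  ⟨fun i a => by
    rw [IsScalarTower.algebraMap_apply A B C, IsScalarTower.algebraMap_apply A B C,
      der_algebraMap (F := B), der_algebraMap (F := A)]⟩

theorem isAlgClosed_constants {K L : Type} [Field K] [DiffField K] [Field L] [DiffField L]
    [Algebra K L] [IsDiffExtension K L] [IsAlgClosed (constants K)]
    (hconst : ∀ c ∈ constants L, ∃ b ∈ constants K, algebraMap K L b = c) :
    IsAlgClosed (constants L) := by
  let f : constants K →+* constants L :=
    { toFun := fun c => ⟨algebraMap K L c, algebraMap_mem_constants_iff.mpr c.2⟩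
      map_one' := Subtype.ext (map_one _)
      map_zero' := Subtype.ext (map_zero _)
      map_mul' := fun a b => Subtype.ext (map_mul (algebraMap K L) (a : K) b)
      map_add' := fun a b => Subtype.ext (map_add (algebraMap K L) (a : K) b) }
  have hf : Function.Bijective f := by
    refine ⟨f.injective, fun c => ?_⟩
    obtain ⟨b, hb, hbc⟩ := hconst c c.2
    exact ⟨⟨b, hb⟩, Subtype.ext hbc⟩
  exact IsAlgClosed.of_ringEquiv _ _ (RingEquiv.ofBijective f hf)

variable {K L : Type} [Field K] [CharZero K] [DiffField K] [IsAlgClosed (constants K)] [Field L]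
  [CharZero L] [DiffField L] [Algebra K L]

/-- If `dω = α ∧ ω` and `dα = 0` over the algebraic closure of a Liouvillian extension, then there
are `m` and `ψ` with `dm = m α` and `dψ = ω / m` in a larger Liouvillian extension. -/
theorem exists_liouvillian_integral (hL : IsLiouvillianExtension K L)
    (ω α : Fin 3 → AlgebraicClosure L)
    (hω : ∀ i j, der i (ω j) - der j (ω i) = α i * ω j - α j * ω i)
    (hα : ∀ i j, der i (α j) = der j (α i)) :
    ∃ (M : Type) (_ : Field M) (_ : DiffField M) (_ : Algebra (AlgebraicClosure L) M)
      (N : Type) (_ : Field N) (_ : DiffField N) (_ : Algebra K N) (j : N →+* M),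
      IsDiffExtension (AlgebraicClosure L) M ∧ IsLiouvillianExtension K N ∧
      (∀ i x, j (der i x) = der i (j x)) ∧
      (∀ x : K, j (algebraMap K N x) =
        algebraMap (AlgebraicClosure L) M (algebraMap K (AlgebraicClosure L) x)) ∧
      (∀ x : L, ∃ y : N, j y =
        algebraMap (AlgebraicClosure L) M (algebraMap L (AlgebraicClosure L) x)) ∧
      ∃ m ψ : N, m ≠ 0 ∧ (∀ i, der i (j m) = algebraMap (AlgebraicClosure L) M (α i) * j m) ∧
        ∀ i, der i (j ψ) = (j m)⁻¹ * algebraMap (AlgebraicClosure L) M (ω i) := by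
  have hKL : IsDiffExtension K L := hL.toIsDiffExtension
  have hconstL : ∀ c ∈ constants L, ∃ b ∈ constants K, algebraMap K L b = c := by
    intro c hc
    rw [← hL.constants_eq] at hc
    exact hc
  have := isAlgClosed_constants hconstL
  obtain ⟨M₁, _, _, _, hext₁, hconst₁, m, hm0, hm⟩ := exists_extension_exponential α hα
  -- The form `ω / m` is closed, because `dm = m α` cancels `dω = α ∧ ω`.
  have hη : ∀ i j, der i (m⁻¹ * algebraMap _ M₁ (ω j)) = der j (m⁻¹ * algebraMap _ M₁ (ω i)) := by
    intro i j
    have h := congrArg (algebraMap (AlgebraicClosure L) M₁) (hω i j)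
    rw [map_sub, map_sub, map_mul, map_mul, ← der_algebraMap, ← der_algebraMap] at h
    rw [der_mul, der_mul, der_inv, der_inv, hm, hm]
    field_simp
    linear_combination h
  have : CharZero M₁ := charZero_of_injective_algebraMap (algebraMap (AlgebraicClosure L) M₁).injective
  obtain ⟨M, _, _, _, hext₂, hconst₂, ψ, hψ⟩ := exists_extension_integral _ hη
  let _ : Algebra (AlgebraicClosure L) M :=
    ((algebraMap M₁ M).comp (algebraMap (AlgebraicClosure L) M₁)).toAlgebra
  have : IsScalarTower (AlgebraicClosure L) M₁ M := IsScalarTower.of_algebraMap_eq fun _ => rfl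
  let _ : Algebra L M := ((algebraMap (AlgebraicClosure L) M).comp (algebraMap L _)).toAlgebra
  have : IsScalarTower L (AlgebraicClosure L) M := IsScalarTower.of_algebraMap_eq fun _ => rfl
  let _ : Algebra K M := ((algebraMap L M).comp (algebraMap K L)).toAlgebra
  have : IsScalarTower K L M := IsScalarTower.of_algebraMap_eq fun _ => rfl
  have hextM := isDiffExtension_trans (AlgebraicClosure L) M₁ M
  have hextLM := isDiffExtension_trans L (AlgebraicClosure L) M
  have hextKM := isDiffExtension_trans K L M
  -- The two adjunctions create no constants, and a constant algebraic over `L` lies in `L` because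
  -- the constants of `L` are algebraically closed.
  have hconst : ∀ c ∈ constants M, ∃ b ∈ constants K, algebraMap K M b = c := by
    intro c hc
    obtain ⟨c₁, rfl⟩ := hconst₂ c hc
    rw [algebraMap_mem_constants_iff] at hc
    obtain ⟨c₂, rfl⟩ := hconst₁ c₁ hc
    rw [algebraMap_mem_constants_iff] at hc
    obtain ⟨c₃, hc₃, rfl⟩ := exists_constant_of_isAlgebraic (F := L) hc
      (Algebra.IsAlgebraic.isAlgebraic c₂)
    obtain ⟨b, hb, rfl⟩ := hconstL c₃ hc₃
    exact ⟨b, hb, rfl⟩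
  have hR₀ : IsReachable ((⊤ : IntermediateField K L).map (IsScalarTower.toAlgHom K L M)) :=
    hL.isReachable_top.map _ fun i x => (der_algebraMap i x).symm
  set E₀ := (⊤ : IntermediateField K L).map (IsScalarTower.toAlgHom K L M) with hE₀
  have hLE₀ : ∀ x : L, algebraMap L M x ∈ E₀ := fun x => ⟨x, trivial, rfl⟩
  have halg : ∀ x : AlgebraicClosure L, IsAlgebraic E₀ (algebraMap _ M x) := by
    intro x
    have h1 : IsAlgebraic L (algebraMap _ M x) :=
      (Algebra.IsAlgebraic.isAlgebraic (R := L) x).algebraMap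
    let f : L →+* E₀ := (algebraMap L M).codRestrict E₀ hLE₀
    exact h1.ringHom_of_comp_eq f (RingHom.id M) f.injective rfl
  classical
  -- `M` contains the whole algebraic closure of `L`. The Liouvillian field `N` is cut out of it as
  -- a finite tower: the image of `L`, the coefficients of `ω` and `α`, then `m`, then `ψ`.
  obtain ⟨E₁, hR₁, hle₁, hmem₁⟩ := hR₀.adjoin_finset
    (Finset.univ.image (fun i => algebraMap _ M (ω i)) ∪
      Finset.univ.image (fun i => algebraMap _ M (α i))) (by
    intro t ht
    simp only [Finset.mem_union, Finset.mem_image, Finset.mem_univ, true_and] at ht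
    rcases ht with ⟨i, rfl⟩ | ⟨i, rfl⟩ <;> exact halg _)
  have hω₁ : ∀ i, algebraMap _ M (ω i) ∈ E₁ := fun i => hmem₁ _ (by simp)
  have hα₁ : ∀ i, algebraMap _ M (α i) ∈ E₁ := fun i => hmem₁ _ (by simp)
  have hm0' : algebraMap M₁ M m ≠ 0 := (_root_.map_ne_zero _).mpr hm0
  have hm' : ∀ i, der i (algebraMap M₁ M m) =
      algebraMap (AlgebraicClosure L) M (α i) * algebraMap M₁ M m := by
    intro i
    rw [der_algebraMap, hm, map_mul]
    rfl
  have hψ' : ∀ i, der i ψ = (algebraMap M₁ M m)⁻¹ * algebraMap (AlgebraicClosure L) M (ω i) := by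
    intro i
    rw [hψ, map_mul, map_inv₀]
    rfl
  obtain ⟨E₂, hR₂, hle₂, hm₂⟩ := hR₁.adjoin_step (algebraMap M₁ M m) (Or.inl ⟨hm0', fun i => by
    rw [hm', mul_div_assoc, div_self hm0', mul_one]
    exact hα₁ i⟩)
  obtain ⟨E₃, hR₃, hle₃, hψ₃⟩ := hR₂.adjoin_step ψ (Or.inr (Or.inl fun i => by
    rw [hψ']
    exact mul_mem (inv_mem hm₂) (hle₂ (hω₁ i))))
  exact ⟨M, inferInstance, inferInstance, inferInstance, E₃, inferInstance,
    subDiffField E₃ hR₃.der_mem, inferInstance, algebraMap E₃ M, hextM,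
    hR₃.isLiouvillianExtension hconst, fun _ _ => rfl, fun _ => rfl,
    fun x => ⟨⟨_, hle₃ (hle₂ (hle₁ (hLE₀ x)))⟩, rfl⟩, ⟨_, hle₃ hm₂⟩, ⟨ψ, hψ₃⟩,
    fun h => hm0' (congrArg Subtype.val h), hm', hψ'⟩

end Integrals

/-! ### Descent along the whole tower. -/

section TowerDescent

variable {K L M : Type*} [Field K] [CharZero K] [DiffField K] [Field L] [DiffField L]
  [Algebra K L] [IsDiffExtension K L] [Field M] [DiffField M] [Algebra K M] [Algebra L M]
  [IsScalarTower K L M] [IsDiffExtension L M] [IsAlgClosed M]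

/-- A Darboux pair over a reachable field gives a Darboux pair over `K`, if all Darboux pairs over
a large algebraically closed field are proportional. -/
theorem IsReachable.exists_isDarbouxPair {Ω : Fin 3 → K}
    (hM : ∀ ω₁ α₁ ω₂ α₂ : Fin 3 → M, IsDarbouxPair (fun i => algebraMap K M (Ω i)) ω₁ α₁ →
      IsDarbouxPair (fun i => algebraMap K M (Ω i)) ω₂ α₂ → wedge ω₁ ω₂ = 0)
    {E : IntermediateField K L} (hE : IsReachable E) {ω α : Fin 3 → L} (hω : ∀ i, ω i ∈ E)
    (hα : ∀ i, α i ∈ E) (H : IsDarbouxPair (fun i => algebraMap K L (Ω i)) ω α) :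
    ∃ ω' α' : Fin 3 → K, IsDarbouxPair Ω ω' α' := by
  induction hE generalizing ω α with
  | bot =>
    choose ω' hω' using fun i => mem_bot.mp (hω i)
    choose α' hα' using fun i => mem_bot.mp (hα i)
    refine ⟨ω', α', IsDarbouxPair.of_map (algebraMap K L) (fun i x => (der_algebraMap i x).symm) ?_⟩
    simpa only [hω', hα'] using H
  | @step E E' hE hstep ih =>
    obtain ⟨t, rfl, ht⟩ := hstep
    let _ := subDiffField E hE.der_mem
    have := isDiffExtension_subDiffField E hE.der_mem
    have := isDiffExtension_base_subDiffField E hE.der_mem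
    suffices h : ∃ ω' α' : Fin 3 → E, IsDarbouxPair (fun i => algebraMap K E (Ω i)) ω' α' by
      obtain ⟨ω', α', h'⟩ := h
      exact ih (fun i => (ω' i).2) (fun i => (α' i).2)
        (h'.map (algebraMap E L) fun _ _ => rfl)
    by_cases halg : IsAlgebraic E t
    · have hS : ∀ i, ∀ x ∈ adjoin E {t}, der i x ∈ adjoin E {t} :=
        (hE.step ⟨t, rfl, ht⟩).der_mem
      let _ := subDiffField (adjoin E {t}) hS
      have := isDiffExtension_base_subDiffField (adjoin E {t}) hS
      have : FiniteDimensional E (adjoin E {t}) := adjoin.finiteDimensional halg.isIntegral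
      have : CharZero E := charZero_of_injective_algebraMap (algebraMap K E).injective
      -- Conjugates over `E` are compared inside `M`, where the proportionality hypothesis applies.
      let _ : Algebra E M := ((algebraMap L M).comp (algebraMap E L)).toAlgebra
      have : IsDiffExtension E M := ⟨fun i x => der_algebraMap (L := M) i (x : L)⟩
      refine exists_isDarbouxPair_of_finite (M := M) (S := adjoin E {t})
        (ω := fun i => ⟨ω i, hω i⟩) (α := fun i => ⟨α i, hα i⟩) ?_
        (IsDarbouxPair.of_map (algebraMap (adjoin E {t}) L) (fun _ _ => rfl) H)
      have e : (fun i => algebraMap E M (algebraMap K E (Ω i))) =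
          fun i => algebraMap K M (Ω i) :=
        funext fun i => (IsScalarTower.algebraMap_apply K L M (Ω i)).symm
      rw [e]
      exact hM
    · refine exists_isDarbouxPair_of_transcendental halg ?_ hω hα H
      rcases ht with ⟨h0, h1⟩ | h1 | h1
      · exact Or.inl fun i => ⟨⟨_, h1 i⟩, (div_mul_cancel₀ _ h0).symm⟩
      · exact Or.inr fun i => ⟨⟨_, h1 i⟩, rfl⟩
      · exact absurd h1 halg

end TowerDescent

/-! ### Exact and logarithmic forms. -/

section LogExact

variable {L : Type*} [Field L] [DiffField L]

/-- Sums of exact forms `dr` and logarithmic forms `c dp / p` with `r`, `p` in the set `S` and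
constants `c`. -/
inductive IsLogExact (S : Set L) : (Fin 3 → L) → Prop
  | exact (r : L) (hr : r ∈ S) : IsLogExact S (fun i => der i r)
  | log (c p : L) (hc : ∀ i, der i c = 0) (hcS : c ∈ S) (hp : p ∈ S) (hp0 : p ≠ 0) :
      IsLogExact S (fun i => c * (der i p / p))
  | add {α β : Fin 3 → L} (hα : IsLogExact S α) (hβ : IsLogExact S β) :
      IsLogExact S (fun i => α i + β i)

theorem IsLogExact.mono {S T : Set L} (hST : S ⊆ T) {α : Fin 3 → L} (h : IsLogExact S α) :
    IsLogExact T α := by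
  induction h with
  | exact r hr => exact .exact r (hST hr)
  | log c p hc hcS hp hp0 => exact .log c p hc (hST hcS) (hST hp) hp0
  | add _ _ ih1 ih2 => exact .add ih1 ih2

theorem IsLogExact.closed {S : Set L} {α : Fin 3 → L} (h : IsLogExact S α) (i j : Fin 3) :
    der i (α j) = der j (α i) := by
  induction h with
  | exact r _ => exact der_comm i j r
  | log c p hc _ _ _ => rw [der_mul, der_mul, hc, hc, der_logDer_comm, zero_mul, zero_mul]
  | add _ _ ih1 ih2 => rw [map_add, map_add, ih1, ih2]

end LogExact

/-! ### Series without pole and their constant terms. -/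

section ConstantTerm

variable {F : Type*} [Field F]

/-- A power series in `s` with constant term `x`. -/
def HasConstantTerm (f : LaurentSeries F) (x : F) : Prop :=
  (∀ j < 0, f.coeff j = 0) ∧ f.coeff 0 = x

theorem HasConstantTerm.add {f g : LaurentSeries F} {x y : F}
    (hf : HasConstantTerm f x) (hg : HasConstantTerm g y) : HasConstantTerm (f + g) (x + y) :=
  ⟨fun j hj => by rw [HahnSeries.coeff_add, hf.1 j hj, hg.1 j hj, add_zero],
    by rw [HahnSeries.coeff_add, hf.2, hg.2]⟩

theorem HasConstantTerm.mul {f g : LaurentSeries F} {x y : F}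
    (hf : HasConstantTerm f x) (hg : HasConstantTerm g y) : HasConstantTerm (f * g) (x * y) :=
  ⟨fun _ hj => coeff_mul_eq_zero hf.1 hg.1 (by simpa using hj), by
    have h := coeff_mul_add hf.1 hg.1
    rwa [add_zero, hf.2, hg.2] at h⟩

theorem hasConstantTerm_algebraMap (x : F) :
    HasConstantTerm (algebraMap F (LaurentSeries F) x) x :=
  ⟨fun _ hj => coeff_algebraMap_of_ne x hj.ne, coeff_algebraMap_zero x⟩

theorem HasConstantTerm.pow {f : LaurentSeries F} {x : F}
    (hf : HasConstantTerm f x) (n : ℕ) : HasConstantTerm (f ^ n) (x ^ n) := by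
  induction n with
  | zero =>
    rw [pow_zero, pow_zero, ← map_one (algebraMap F (LaurentSeries F))]
    exact hasConstantTerm_algebraMap 1
  | succ n ih => rw [pow_succ, pow_succ]; exact ih.mul hf

end ConstantTerm

/-! ### Closed forms over `E(z)`: residues and Hermite reduction. -/

section OneVariable

theorem exists_derivative_eq {E : Type*} [Field E] [CharZero E] (a : E[X]) : ∃ b : E[X], derivative b = a := by
  induction a using Polynomial.induction_on' with
  | add a b ha hb =>
    obtain ⟨a', rfl⟩ := ha
    obtain ⟨b', rfl⟩ := hb
    exact ⟨a' + b', derivative_add⟩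
  | monomial n c =>
    refine ⟨monomial (n + 1) (c / (n + 1)), ?_⟩
    have hn : ((n : E) + 1) ≠ 0 := Nat.cast_add_one_ne_zero n
    rw [derivative_monomial, Nat.add_sub_cancel]
    push_cast
    rw [div_mul_cancel₀ _ hn]

variable {E L : Type*} [Field E] [DiffField E] [Field L] [DiffField L] [Algebra E L]
  [IsDiffExtension E L]

theorem der_aeval_of_coeff (k : Fin 3) {z : L} (hz : der k z = 1) (hE : ∀ b : E, der k b = 0)
    (p : E[X]) : der k (aeval z p) = aeval z (derivative p) := by
  have h : coeffDer k p = 0 := by ext n; simp [hE]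
  rw [der_aeval, h, map_zero, zero_add, hz, mul_one]

theorem der_mem_adjoin_variable {z : L} {k : Fin 3} (hz : ∀ i, der i z = if i = k then 1 else 0) :
    ∀ i, ∀ x ∈ E⟮z⟯, der i x ∈ E⟮z⟯ := by
  refine der_mem_adjoin fun i x hx => ?_
  obtain rfl := Set.mem_singleton_iff.mp hx
  rw [hz]
  split_ifs
  · exact one_mem _
  · exact zero_mem _

variable [CharZero E]

/-- An algebraic element would have derivative zero, as `der k` vanishes on `E`. -/
theorem transcendental_of_der {z : L} {k : Fin 3} (hz : der k z = 1)
    (hE : ∀ b : E, der k b = 0) : Transcendental E z := by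
  intro h
  rw [der_eq_zero_of_isAlgebraic k h hE] at hz
  exact zero_ne_one hz

/-- Elements of `E(z)` whose derivative with respect to `z` vanishes are in `E`. -/
theorem exists_eq_algebraMap_of_der_variable {z : L} {k : Fin 3}
    (hz : ∀ i, der i z = if i = k then 1 else 0) (hE : ∀ b : E, der k b = 0) {x : L}
    (hx : x ∈ E⟮z⟯) (hder : der k x = 0) : ∃ b : E, algebraMap E L b = x := by
  have hS := der_mem_adjoin_variable (E := E) hz
  have hzt : Transcendental E z := transcendental_of_der (k := k) (by simp [hz]) hE
  obtain ⟨ι, hι⟩ := exists_adjoin_hom hzt (transcendental_single (F := E) (n := -1) (by norm_num))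
  -- Expansion at infinity: `s = 1/z`, so `ds = -s² dz`.
  let a : Fin 3 → E := fun i => if i = k then -1 else 0
  have ha : ∀ i j, der i (a j) = der j (a i) := by
    have h0 : ∀ i j, der i (a j) = 0 := by
      intro i j
      change der i (if j = k then (-1 : E) else 0) = 0
      split_ifs <;> simp
    intro i j
    rw [h0, h0]
  let _ := subDiffField E⟮z⟯ hS
  let _ := laurentDiffField 1 a ha
  have := isDiffExtension_laurent 1 a ha
  have hcomm := adjoin_hom_der hS ι k (by
    have e : (⟨der k z, hS k z (mem_adjoin_simple_self E z)⟩ : E⟮z⟯) = 1 :=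
      Subtype.ext (by simp [hz])
    rw [e, map_one, hι]
    refine Eq.trans ?_ (laurentDer_single 1 a k (-1)).symm
    simp [a]) ⟨x, hx⟩
  have e : (⟨der k x, hS k x hx⟩ : E⟮z⟯) = 0 := Subtype.ext hder
  rw [e, map_zero] at hcomm
  obtain ⟨b, hb⟩ := exists_eq_algebraMap_of_der_eq_zero a k (by simp [a]) hE hcomm.symm
  rw [← ι.commutes b] at hb
  exact ⟨b, congrArg Subtype.val (ι.injective hb)⟩

/-- The residue of a closed 1-form at a simple pole is constant. -/
theorem exists_constant_residue [IsAlgClosed (constants E)] {z : L} {k : Fin 3}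
    (hz : ∀ i, der i z = if i = k then 1 else 0) (hE : ∀ b : E, der k b = 0) {α : Fin 3 → L}
    (hα : ∀ i, α i ∈ E⟮z⟯) (hclosed : ∀ i j, der i (α j) = der j (α i)) {p b u v : E[X]}
    (hp : Irreducible p) (hb : ¬ p ∣ b)
    (heq : α k * (aeval z p * aeval z b) = aeval z u * aeval z b + aeval z v * aeval z p) :
    ∃ c : E, (∀ i, der i c = 0) ∧ p ∣ u - C c * derivative p := by
  obtain ⟨ξ, hξ⟩ := IsAlgClosed.exists_aeval_eq_zero (AlgebraicClosure E) p hp.degree_pos.ne'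
  have hEbar : ∀ x : AlgebraicClosure E, der k x = 0 := fun x =>
    der_eq_zero_of_isAlgebraic k (Algebra.IsAlgebraic.isAlgebraic x) hE
  have hdvd : ∀ q : E[X], aeval ξ q = 0 → p ∣ q := fun q hq =>
    ((minpoly.irreducible (Algebra.IsIntegral.isIntegral ξ)).dvd_symm hp
      (minpoly.dvd E ξ hξ)).trans (minpoly.dvd E ξ hq)
  have hb' : aeval ξ b ≠ 0 := fun h => hb (hdvd b h)
  have hp' : aeval ξ (derivative p) ≠ 0 := hp.separable.aeval_derivative_ne_zero hξ
  -- Expansion at the root `ξ` of `p`: `s = z - ξ`, so `ds = dz - dξ`, which is the case `k = -1` of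
  -- `laurentDiffField`. The series `τ = ξ + s` below is the image of `z`.
  let a : Fin 3 → AlgebraicClosure E := fun i => (if i = k then 1 else 0) - der i ξ
  have ha : ∀ i j, der i (a j) = der j (a i) := by
    have h0 : ∀ i j, der i (a j) = -der i (der j ξ) := by
      intro i j
      change der i ((if j = k then (1 : AlgebraicClosure E) else 0) - der j ξ) = _
      split_ifs <;> simp
    intro i j
    rw [h0, h0, der_comm i j]
  have hak : a k = 1 := by simp [a, hEbar]
  let _ := laurentDiffField (-1) a ha
  have := isDiffExtension_laurent (-1) a ha
  let _ : Algebra E (LaurentSeries (AlgebraicClosure E)) :=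
    ((algebraMap (AlgebraicClosure E) (LaurentSeries (AlgebraicClosure E))).comp
      (algebraMap E (AlgebraicClosure E))).toAlgebra
  have : IsDiffExtension E (LaurentSeries (AlgebraicClosure E)) := ⟨fun i x => by
    change der i (algebraMap (AlgebraicClosure E) (LaurentSeries (AlgebraicClosure E))
      (algebraMap E _ x)) = algebraMap (AlgebraicClosure E) _ (algebraMap E _ (der i x))
    rw [der_algebraMap (F := AlgebraicClosure E), der_algebraMap (F := E)]⟩
  set τ : LaurentSeries (AlgebraicClosure E) :=
    algebraMap (AlgebraicClosure E) _ ξ + HahnSeries.single 1 1 with hτdef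
  have hτ : ∀ i, der i τ = if i = k then 1 else 0 := by
    intro i
    rw [hτdef, map_add, der_algebraMap]
    have h1 : der i (HahnSeries.single 1 1 : LaurentSeries (AlgebraicClosure E)) =
        algebraMap (AlgebraicClosure E) _ (a i) := by
      refine (laurentDer_single (-1) a i 1).trans ?_
      rw [algebraMap_laurent, HahnSeries.C_apply]
      simp
    rw [h1, ← map_add, add_sub_cancel]
    split_ifs <;> simp
  have hτ0 : HasConstantTerm τ ξ := by
    have h1 : HasConstantTerm (HahnSeries.single 1 1 : LaurentSeries (AlgebraicClosure E)) 0 :=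
      ⟨fun _ hj => HahnSeries.coeff_single_of_ne (by omega),
        HahnSeries.coeff_single_of_ne (by norm_num)⟩
    simpa using (hasConstantTerm_algebraMap ξ).add h1
  have hpoly : ∀ q : E[X], HasConstantTerm (aeval τ q) (aeval ξ q) := by
    intro q
    induction q using Polynomial.induction_on' with
    | add q r hq hr => rw [map_add, map_add]; exact hq.add hr
    | monomial n c =>
      rw [aeval_monomial, aeval_monomial]
      exact (hasConstantTerm_algebraMap _).mul (hτ0.pow n)
  have hS := der_mem_adjoin_variable (E := E) hz
  have hzt : Transcendental E z := transcendental_of_der (k := k) (by simp [hz]) hE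
  have hτt : Transcendental E τ := transcendental_of_der (k := k) (by simp [hτ]) hE
  obtain ⟨ι, hι⟩ := exists_adjoin_hom hzt hτt
  let _ := subDiffField E⟮z⟯ hS
  have hcomm : ∀ i (x : E⟮z⟯), ι ⟨der i (x : L), hS i x x.2⟩ = der i (ι x) := fun i =>
    adjoin_hom_der hS ι i (by
      have e : (⟨der i z, hS i z (mem_adjoin_simple_self E z)⟩ : E⟮z⟯) =
          if i = k then 1 else 0 := Subtype.ext ((hz i).trans (by split_ifs <;> rfl))
      rw [e, hι, hτ]
      split_ifs <;> simp)
  have hιpoly : ∀ q : E[X], ι (aeval (AdjoinSimple.gen E z) q) = aeval τ q := by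
    intro q
    rw [← hι, aeval_algHom_apply]
  set f : LaurentSeries (AlgebraicClosure E) := ι ⟨α k, hα k⟩ with hf
  have hfeq : f * (aeval τ p * aeval τ b) = aeval τ u * aeval τ b + aeval τ v * aeval τ p := by
    have e : (⟨α k, hα k⟩ : E⟮z⟯) *
        (aeval (AdjoinSimple.gen E z) p * aeval (AdjoinSimple.gen E z) b) =
        aeval (AdjoinSimple.gen E z) u * aeval (AdjoinSimple.gen E z) b +
        aeval (AdjoinSimple.gen E z) v * aeval (AdjoinSimple.gen E z) p :=
      Subtype.ext (by simpa using heq)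
    have h := congrArg ι e
    simpa only [map_mul, map_add, hιpoly] using h
  have hP0 : ∀ j < 1, (aeval τ p).coeff j = 0 := by
    intro j hj
    rcases lt_or_eq_of_le (Int.lt_add_one_iff.mp hj : j ≤ 0) with h | rfl
    · exact (hpoly p).1 j h
    · rw [(hpoly p).2, hξ]
  have hP1 : (aeval τ p).coeff 1 = aeval ξ (derivative p) := by
    have h1 := der_aeval_of_coeff k (z := τ) (by simp [hτ]) hE p
    have h2 := congrArg (fun g => HahnSeries.coeff g 0) h1
    have h3 := coeff_laurentDer (-1) a k (aeval τ p) 0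
    rw [hEbar, hak] at h3
    rw [← (hpoly (derivative p)).2, ← h2]
    refine Eq.trans ?_ h3.symm
    simp
  set G := aeval τ p * aeval τ b with hG
  have hG0 : ∀ j < 1, G.coeff j = 0 := fun j hj =>
    coeff_mul_eq_zero hP0 (hpoly b).1 (by simpa using hj)
  have hG1 : G.coeff 1 = aeval ξ (derivative p) * aeval ξ b := by
    have h := coeff_mul_add hP0 (hpoly b).1
    rwa [add_zero, hP1, (hpoly b).2] at h
  have hG1' : G.coeff 1 ≠ 0 := by
    rw [hG1]
    exact mul_ne_zero hp' hb'
  have hH := ((hpoly u).mul (hpoly b)).add ((hpoly v).mul (hpoly p))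
  rw [← hfeq] at hH
  -- `G` has a simple zero at `s = 0` and `f * G` has no pole, so the pole of `f` is at most simple.
  have hford : ∀ j < -1, f.coeff j = 0 := by
    rcases eq_or_ne f 0 with hf0 | hf0
    · intro j _
      rw [hf0, HahnSeries.coeff_zero]
    · have hN : -1 ≤ f.order := by
        by_contra hlt
        have h := coeff_mul_add (f := f) (g := G) (m := f.order) (n := 1)
          (fun i hi => HahnSeries.coeff_eq_zero_of_lt_order hi) hG0
        rw [hH.1 _ (by omega)] at h
        rcases mul_eq_zero.mp h.symm with h | h
        · exact hf0 (HahnSeries.coeff_order_eq_zero.mp h)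
        · exact hG1' h
      exact fun j hj => HahnSeries.coeff_eq_zero_of_lt_order (by omega)
  have hres : f.coeff (-1) * aeval ξ (derivative p) = aeval ξ u := by
    have h := coeff_mul_add hford hG0
    rw [show (-1 : ℤ) + 1 = 0 by norm_num, hH.2, hξ, mul_zero, add_zero, hG1] at h
    apply mul_right_cancel₀ hb'
    linear_combination -h
  -- Taking residues commutes with the derivations: in degree `-1` the contribution of `ds` carries
  -- the factor `-1 + 1 = 0`.
  have hcoeff : ∀ (i : Fin 3) (g : LaurentSeries (AlgebraicClosure E)),
      (der i g).coeff (-1) = der i (g.coeff (-1)) := by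
    intro i g
    refine (coeff_laurentDer (-1) a i g (-1)).trans ?_
    simp
  -- By closedness, `der i` of the residue of `α k` is `der k` of the residue of `α i`, and `der k`
  -- vanishes on everything algebraic over `E`.
  have hconst : f.coeff (-1) ∈ constants (AlgebraicClosure E) := by
    intro i
    rw [← hcoeff, hf, ← hcomm]
    have e : (⟨der i (α k), hS i _ (hα k)⟩ : E⟮z⟯) = ⟨der k (α i), hS k _ (hα i)⟩ :=
      Subtype.ext (hclosed i k)
    rw [e, hcomm k ⟨α i, hα i⟩, hcoeff, hEbar]
  obtain ⟨c, hc, hcf⟩ := exists_constant_of_isAlgebraic (F := E) hconst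
    (Algebra.IsAlgebraic.isAlgebraic _)
  refine ⟨c, hc, hdvd _ ?_⟩
  rw [map_sub, map_mul, aeval_C, hcf, hres, sub_self]

/-- Integration with respect to `z` of the `dz`-coefficient of a closed 1-form over `E(z)`. -/
theorem exists_isLogExact_coeff_eq [IsAlgClosed (constants E)] {z : L} {k : Fin 3}
    (hz : ∀ i, der i z = if i = k then 1 else 0) (hE : ∀ b : E, der k b = 0) (n : ℕ) :
    ∀ (a b : E[X]) (α : Fin 3 → L), b.natDegree ≤ n → b ≠ 0 → (∀ i, α i ∈ E⟮z⟯) →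
      (∀ i j, der i (α j) = der j (α i)) → α k * aeval z b = aeval z a →
      ∃ β, IsLogExact (E⟮z⟯ : Set L) β ∧ α k = β k := by
  have hS := der_mem_adjoin_variable (E := E) hz
  have hzt : Transcendental E z := transcendental_of_der (k := k) (by simp [hz]) hE
  have hne : ∀ q : E[X], q ≠ 0 → aeval z q ≠ 0 := fun q hq h =>
    hq ((transcendental_iff.mp hzt) q h)
  have hmem : ∀ q : E[X], aeval z q ∈ E⟮z⟯ := fun q =>
    (mem_adjoin_simple_iff E _).mpr ⟨q, 1, by simp⟩
  have hd := der_aeval_of_coeff k (z := z) (by simp [hz]) hE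
  induction n with
  | zero =>
    intro a b α hdeg hb0 hα hcl heq
    obtain ⟨c, rfl⟩ := natDegree_eq_zero.mp (Nat.le_zero.mp hdeg)
    have hc0 : c ≠ 0 := by
      rintro rfl
      exact hb0 C_0
    -- With constant denominator, `α k` is a polynomial in `z` and has a polynomial antiderivative.
    obtain ⟨A, hA⟩ := exists_derivative_eq (C c⁻¹ * a)
    refine ⟨_, .exact (aeval z A) (hmem A), ?_⟩
    have hcL : algebraMap E L c ≠ 0 := (_root_.map_ne_zero _).mpr hc0
    rw [aeval_C] at heq
    rw [hd, hA, map_mul, ← heq, aeval_C, map_inv₀]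
    field_simp
  | succ n ih =>
    intro a b α hdeg hb0 hα hcl heq
    rcases Nat.eq_zero_or_pos b.natDegree with h0 | hpos
    · exact ih a b α (by omega) hb0 hα hcl heq
    obtain ⟨p, hp, hpb⟩ := WfDvdMonoid.exists_irreducible_factor
      (fun h => hpos.ne' (natDegree_eq_zero_of_isUnit h)) hb0
    have hfin : FiniteMultiplicity p b :=
      FiniteMultiplicity.of_not_isUnit hp.not_isUnit hb0
    obtain ⟨b₁, hb₁, hnd⟩ := hfin.exists_eq_pow_mul_and_not_dvd
    obtain ⟨l, hl⟩ : ∃ l, multiplicity p b = l + 1 :=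
      Nat.exists_eq_succ_of_ne_zero fun h0 => hnd (by
        rw [h0, pow_zero, one_mul] at hb₁
        rwa [← hb₁])
    rw [hl] at hb₁
    have hp0 := hp.ne_zero
    have hb₁0 : b₁ ≠ 0 := by
      rintro rfl
      exact hnd (dvd_zero p)
    have hpz := hne p hp0
    have hbz := hne b₁ hb₁0
    have hpdeg := hp.natDegree_pos
    have hcop : IsCoprime p b₁ := (hp.coprime_iff_not_dvd).mpr hnd
    have hlow : (p ^ l * b₁).natDegree ≤ n := by
      rw [hb₁, natDegree_mul (pow_ne_zero _ hp0) hb₁0, natDegree_pow, Nat.succ_mul] at hdeg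
      rw [natDegree_mul (pow_ne_zero _ hp0) hb₁0, natDegree_pow]
      omega
    have hlow0 : p ^ l * b₁ ≠ 0 := mul_ne_zero (pow_ne_zero _ hp0) hb₁0
    -- It suffices to lower the exponent of `p` in the denominator by one. Subtracting a closed form
    -- keeps `α` closed, so residues stay constant in the later rounds.
    suffices h : ∃ β₀, IsLogExact (E⟮z⟯ : Set L) β₀ ∧ (∀ i, β₀ i ∈ E⟮z⟯) ∧
        ∃ a', (α k - β₀ k) * aeval z (p ^ l * b₁) = aeval z a' by
      obtain ⟨β₀, hβ₀, hβ₀m, a', ha'⟩ := h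
      obtain ⟨β, hβ, hβk⟩ := ih a' (p ^ l * b₁) (fun i => α i - β₀ i) hlow hlow0
        (fun i => sub_mem (hα i) (hβ₀m i))
        (fun i j => by rw [map_sub, map_sub, hcl i j, hβ₀.closed i j]) ha'
      exact ⟨_, hβ.add hβ₀, by rw [← hβk, sub_add_cancel]⟩
    rw [hb₁] at heq
    rcases Nat.eq_zero_or_pos l with rfl | hlpos
    -- Simple factor: with `s p + t b₁ = 1`, partial fractions isolate `a t / p`, and its constant
    -- residue `c` makes `c dp/p` remove the pole along `p`.
    · obtain ⟨s, t, hst⟩ := hcop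
      have heq' : α k * (aeval z p * aeval z b₁) =
          aeval z (a * t) * aeval z b₁ + aeval z (a * s) * aeval z p := by
        have h := congrArg (aeval z) (congrArg (fun q => a * q) hst)
        simp only [map_mul, map_add, map_one, map_pow] at h heq ⊢
        linear_combination heq - h
      obtain ⟨c, hc, w, hw⟩ := exists_constant_residue hz hE hα hcl hp hnd heq'
      refine ⟨_, .log (algebraMap E L c) (aeval z p)
        (fun i => by rw [der_algebraMap, hc, map_zero])
        (IntermediateField.algebraMap_mem _ _) (hmem p) hpz, fun i => ?_,
        w * b₁ + a * s, ?_⟩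
      · exact mul_mem (IntermediateField.algebraMap_mem _ _)
          (div_mem (hS i _ (hmem p)) (hmem p))
      · have h := congrArg (aeval z) hw
        rw [hd]
        simp only [map_mul, map_add, map_sub, aeval_C, pow_zero, one_mul] at h heq' ⊢
        apply mul_left_cancel₀ hpz
        have e : aeval z p * ((α k - algebraMap E L c * (aeval z (derivative p) / aeval z p)) *
            aeval z b₁) = α k * (aeval z p * aeval z b₁) -
            algebraMap E L c * aeval z (derivative p) * aeval z b₁ := by
          field_simp
        rw [e]
        linear_combination heq' + aeval z b₁ * h
    -- Hermite reduction: with `s p + t p' b₁ = 1`, the part `a t p' / p ^ (l + 1)` is the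
    -- derivative of `-a t / (l p ^ l)` up to a term with denominator `p ^ l`.
    · have hcop' : IsCoprime p (derivative p * b₁) :=
        IsCoprime.mul_right hp.separable hcop
      obtain ⟨s, t, hst⟩ := hcop'
      have hl0 : (l : L) ≠ 0 := by
        have := charZero_of_injective_algebraMap (algebraMap E L).injective
        exact_mod_cast hlpos.ne'
      have hl0E : (l : E) ≠ 0 := by exact_mod_cast hlpos.ne'
      have hr : -(aeval z (C (l : E)⁻¹ * (a * t)) / aeval z p ^ l) ∈ E⟮z⟯ :=
        neg_mem (div_mem (hmem _) (pow_mem (hmem p) l))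
      refine ⟨_, .exact _ hr, fun i => hS i _ hr,
        a * s + C (l : E)⁻¹ * derivative (a * t) * b₁, ?_⟩
      have h := congrArg (aeval z) (congrArg (fun q => a * q) hst)
      rw [map_neg, der_div _ _ (pow_ne_zero l hpz), der_pow, hd, hd]
      have hder : derivative (C (l : E)⁻¹ * (a * t)) = C (l : E)⁻¹ * derivative (a * t) :=
        derivative_C_mul _ _
      rw [hder]
      -- Removes the truncated subtraction in the exponent coming from `der_pow`.
      obtain ⟨l', rfl⟩ : ∃ l', l = l' + 1 := Nat.exists_eq_succ_of_ne_zero hlpos.ne'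
      simp only [Nat.add_sub_cancel]
      simp only [map_mul, map_add, map_pow, map_one, aeval_C, map_inv₀,
        map_natCast] at h heq ⊢
      generalize aeval z (derivative (a * t)) = U' at *
      generalize aeval z (derivative p) = p' at *
      generalize aeval z p = P at *
      generalize aeval z b₁ = B at *
      generalize aeval z a = A at *
      generalize aeval z s = S at *
      generalize aeval z t = T at *
      generalize α k = α' at *
      generalize ((l' + 1 : ℕ) : L) = l at *
      apply mul_left_cancel₀ hpz
      have e : P * ((α' - -((l⁻¹ * U' * P ^ (l' + 1) - l⁻¹ * (A * T) * (l * P ^ l' * p')) /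
          (P ^ (l' + 1)) ^ 2)) * (P ^ (l' + 1) * B)) =
          α' * (P ^ (l' + 1 + 1) * B) + l⁻¹ * U' * P * B - A * T * p' * B := by
        field_simp
        ring
      rw [e]
      linear_combination heq - h

/-- Closed 1-forms over `E(z)` are closed 1-forms over `E` up to exact and logarithmic forms. -/
theorem exists_isLogExact_sub_mem [IsAlgClosed (constants E)] {z : L} {k : Fin 3}
    (hz : ∀ i, der i z = if i = k then 1 else 0) (hE : ∀ b : E, der k b = 0) {α : Fin 3 → L}
    (hα : ∀ i, α i ∈ E⟮z⟯) (hclosed : ∀ i j, der i (α j) = der j (α i)) :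
    ∃ β, IsLogExact (E⟮z⟯ : Set L) β ∧ ∃ γ : Fin 3 → E, ∀ i, α i = algebraMap E L (γ i) + β i := by
  have hS := der_mem_adjoin_variable (E := E) hz
  obtain ⟨a, b, hab⟩ := (mem_adjoin_simple_iff E _).mp (hα k)
  obtain ⟨β, hβ, hβk⟩ : ∃ β, IsLogExact (E⟮z⟯ : Set L) β ∧ α k = β k := by
    -- The quotient presentation allows a zero denominator, in which case `α k = 0`.
    by_cases hb : aeval z b = 0
    · refine ⟨_, .exact 0 (zero_mem _), ?_⟩
      rw [hab, hb, div_zero, map_zero]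
    · refine exists_isLogExact_coeff_eq hz hE b.natDegree a b α le_rfl ?_ hα hclosed ?_
      · rintro rfl
        exact hb (map_zero _)
      · rw [hab, div_mul_cancel₀ _ hb]
  have hβm : ∀ i, β i ∈ E⟮z⟯ := by
    clear hβk
    induction hβ with
    | exact r hr => exact fun i => hS i r hr
    | log c p _ hcS hp _ => exact fun i => mul_mem hcS (div_mem (hS i p hp) hp)
    | add _ _ ih1 ih2 => exact fun i => add_mem (ih1 i) (ih2 i)
  -- The `k`-th component of `α - β` is zero, so closedness makes the `k`-derivative of every
  -- component vanish.
  have hγ : ∀ i, ∃ c : E, algebraMap E L c = α i - β i := by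
    intro i
    refine exists_eq_algebraMap_of_der_variable hz hE (sub_mem (hα i) (hβm i)) ?_
    rw [map_sub, hclosed k i, hβ.closed k i, hβk, sub_self]
  choose γ hγ using hγ
  exact ⟨β, hβ, γ, fun i => by rw [hγ, sub_add_cancel]⟩

end OneVariable

/-! ### Constants and closed 1-forms of `ℂ(x, y, z)`. -/

section RationalFunctions

/-- A field with zero derivations. -/
abbrev trivialDiffField (F : Type*) [Field F] : DiffField F where
  der _ := 0
  der_mul _ _ _ := by simp
  der_comm _ _ _ := rfl

/-- The coordinate functions `x`, `y`, `z`. -/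
def coordinate (i : Fin 3) : RatFun3 := algebraMap Poly RatFun3 (MvPolynomial.X i)

theorem der_coordinate (i j : Fin 3) : der i (coordinate j) = if i = j then 1 else 0 := by
  rw [der_ratFun3, coordinate, ratDeriv_algebraMap, MvPolynomial.pderiv_X, Pi.single_apply]
  split_ifs with h1 h2 h2
  · exact map_one _
  · exact absurd h1.symm h2
  · exact absurd h2.symm h1
  · exact map_zero _

theorem der_algebraMap_complex (i : Fin 3) (c : ℂ) : der i (algebraMap ℂ RatFun3 c) = 0 :=
  (ratDeriv i).map_algebraMap c

/-- The field of rational functions in the first `n` variables. -/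
def firstVariables (n : ℕ) : IntermediateField ℂ RatFun3 :=
  adjoin ℂ {x | ∃ j : Fin 3, (j : ℕ) < n ∧ x = coordinate j}

theorem firstVariables_zero : firstVariables 0 = ⊥ := by
  have : {x | ∃ j : Fin 3, (j : ℕ) < 0 ∧ x = coordinate j} = ∅ := by
    ext x
    simp
  rw [firstVariables, this, adjoin_empty]

/-- Presents each field as `E(z)` over the previous one, the setting of the one-variable results. -/
theorem firstVariables_succ (n : Fin 3) :
    (adjoin (firstVariables n) {coordinate n}).restrictScalars ℂ = firstVariables (n + 1) := by
  rw [firstVariables, firstVariables, adjoin_adjoin_left]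
  congr 1
  ext x
  simp only [Set.mem_union, Set.mem_ofPred_eq, Set.mem_singleton_iff]
  constructor
  · rintro (⟨j, hj, rfl⟩ | rfl)
    · exact ⟨j, by omega, rfl⟩
    · exact ⟨n, by omega, rfl⟩
  · rintro ⟨j, hj, rfl⟩
    rcases Nat.lt_succ_iff_lt_or_eq.mp hj with h | h
    · exact Or.inl ⟨j, h, rfl⟩
    · exact Or.inr (by rw [Fin.ext h])

theorem firstVariables_three : firstVariables 3 = ⊤ := by
  rw [eq_top_iff]
  rintro r -
  have hpoly : ∀ p : Poly, algebraMap Poly RatFun3 p ∈ firstVariables 3 := by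
    intro p
    induction p using MvPolynomial.induction_on with
    | C c => exact (firstVariables 3).algebraMap_mem c
    | add p q hp hq => rw [map_add]; exact add_mem hp hq
    | mul_X p i hp =>
      rw [map_mul]
      exact mul_mem hp (subset_adjoin ℂ _ ⟨i, i.2, rfl⟩)
  obtain ⟨a, s, -, rfl⟩ := exists_eq_div r
  exact div_mem (hpoly a) (hpoly s)

theorem der_mem_firstVariables (n : ℕ) :
    ∀ i, ∀ x ∈ firstVariables n, der i x ∈ firstVariables n := by
  let _ := trivialDiffField ℂ
  have : IsDiffExtension ℂ RatFun3 :=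
    ⟨fun i c => (der_algebraMap_complex i c).trans (map_zero _).symm⟩
  refine der_mem_adjoin ?_
  rintro i x ⟨j, hj, rfl⟩
  rw [der_coordinate]
  split_ifs
  · exact one_mem _
  · exact zero_mem _

theorem der_eq_zero_of_mem_firstVariables {n : ℕ} {k : Fin 3} (hk : n ≤ k) {x : RatFun3}
    (hx : x ∈ firstVariables n) : der k x = 0 := by
  induction hx using adjoin_induction with
  | mem x hx =>
    obtain ⟨j, hj, rfl⟩ := hx
    rw [der_coordinate, if_neg]
    rintro rfl
    omega
  | algebraMap c => exact der_algebraMap_complex k c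
  | add x y _ _ h1 h2 => rw [map_add, h1, h2, add_zero]
  | inv x _ h1 => rw [der_inv, h1, neg_zero, zero_div]
  | mul x y _ _ h1 h2 => rw [der_mul, h1, h2, zero_mul, mul_zero, add_zero]

/-- The constants of `ℂ(x, y, z)` are the complex numbers. -/
theorem exists_complex_of_constant {c : RatFun3} (hc : ∀ i, der i c = 0) :
    ∃ b : ℂ, algebraMap ℂ RatFun3 b = c := by
  -- The variables are removed one at a time: a constant in `E(z)` has zero `z`-derivative, hence
  -- lies in `E`.
  have h : ∀ n ≤ 3, c ∈ firstVariables (3 - n) := by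
    intro n
    induction n with
    | zero =>
      intro _
      rw [Nat.sub_zero, firstVariables_three]
      trivial
    | succ n ih =>
      intro hn
      have hmem := ih (by omega)
      let k : Fin 3 := ⟨3 - (n + 1), by omega⟩
      have hk : 3 - n = (k : ℕ) + 1 := by simp only [k]; omega
      rw [hk, ← firstVariables_succ k] at hmem
      let _ := subDiffField (firstVariables k) (der_mem_firstVariables k)
      have := isDiffExtension_subDiffField (firstVariables k) (der_mem_firstVariables k)
      obtain ⟨b, rfl⟩ := exists_eq_algebraMap_of_der_variable (E := firstVariables k) (k := k)
        (fun i => der_coordinate i k)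
        (fun b => Subtype.ext (der_eq_zero_of_mem_firstVariables le_rfl b.2)) hmem (hc k)
      exact b.2
  have h0 := h 3 le_rfl
  rw [Nat.sub_self, firstVariables_zero] at h0
  exact mem_bot.mp h0

theorem isAlgClosed_constants_firstVariables (n : ℕ) :
    letI := subDiffField (firstVariables n) (der_mem_firstVariables n)
    IsAlgClosed (constants (firstVariables n)) := by
  let _ := subDiffField (firstVariables n) (der_mem_firstVariables n)
  let f : ℂ →+* constants (firstVariables n) :=
    { toFun := fun c => ⟨algebraMap ℂ (firstVariables n) c,
        fun i => Subtype.ext (der_algebraMap_complex i c)⟩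
      map_one' := Subtype.ext (map_one _)
      map_zero' := Subtype.ext (map_zero _)
      map_mul' := fun a b => Subtype.ext (map_mul (algebraMap ℂ (firstVariables n)) a b)
      map_add' := fun a b => Subtype.ext (map_add (algebraMap ℂ (firstVariables n)) a b) }
  have hf : Function.Bijective f := by
    refine ⟨f.injective, fun c => ?_⟩
    obtain ⟨b, hb⟩ := exists_complex_of_constant (c := ((c : firstVariables n) : RatFun3))
      fun i => congrArg Subtype.val (c.2 i)
    exact ⟨b, Subtype.ext (Subtype.ext hb)⟩
  exact IsAlgClosed.of_ringEquiv _ _ (RingEquiv.ofBijective f hf)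

theorem isAlgClosed_constants_ratFun3 : IsAlgClosed (constants RatFun3) := by
  let f : ℂ →+* constants RatFun3 :=
    { toFun := fun c => ⟨algebraMap ℂ RatFun3 c, fun i => der_algebraMap_complex i c⟩
      map_one' := Subtype.ext (map_one _)
      map_zero' := Subtype.ext (map_zero _)
      map_mul' := fun a b => Subtype.ext (map_mul (algebraMap ℂ RatFun3) a b)
      map_add' := fun a b => Subtype.ext (map_add (algebraMap ℂ RatFun3) a b) }
  have hf : Function.Bijective f := by
    refine ⟨f.injective, fun c => ?_⟩
    obtain ⟨b, hb⟩ := exists_complex_of_constant c.2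
    exact ⟨b, Subtype.ext hb⟩
  exact IsAlgClosed.of_ringEquiv _ _ (RingEquiv.ofBijective f hf)

/-- Closed rational 1-forms are sums of exact and logarithmic forms. -/
theorem isLogExact_of_closed {α : Fin 3 → RatFun3} (hα : ∀ i j, der i (α j) = der j (α i)) :
    IsLogExact Set.univ α := by
  have h : ∀ n ≤ 3, ∀ α : Fin 3 → RatFun3, (∀ i, α i ∈ firstVariables n) →
      (∀ i j, der i (α j) = der j (α i)) → IsLogExact Set.univ α := by
    intro n
    induction n with
    | zero =>
      intro _ α hα _
      rw [firstVariables_zero] at hα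
      choose c hc using fun i => mem_bot.mp (hα i)
      -- A form with complex coefficients is the differential of a linear function.
      have e : α = fun i => der i (∑ j, algebraMap ℂ RatFun3 (c j) * coordinate j) := by
        funext i
        simp only [map_sum, der_mul, der_algebraMap_complex, der_coordinate, zero_mul, zero_add,
          mul_ite, mul_one, mul_zero, Finset.sum_ite_eq, Finset.mem_univ, if_true]
        exact (hc i).symm
      rw [e]
      exact .exact _ trivial
    | succ n ih =>
      intro hn α hα hcl
      let k : Fin 3 := ⟨n, by omega⟩
      let _ := subDiffField (firstVariables k) (der_mem_firstVariables k)
      have := isDiffExtension_subDiffField (firstVariables k) (der_mem_firstVariables k)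
      have := isAlgClosed_constants_firstVariables k
      obtain ⟨β, hβ, γ, hγ⟩ := exists_isLogExact_sub_mem (E := firstVariables k)
        (k := k) (z := coordinate k) (fun i => der_coordinate i k)
        (fun b => Subtype.ext (der_eq_zero_of_mem_firstVariables le_rfl b.2))
        (fun i => by
          have h := hα i
          rwa [← firstVariables_succ k] at h) hcl
      have hγcl : ∀ i j, der i (γ j : RatFun3) = der j (γ i : RatFun3) := by
        intro i j
        have hv : ∀ i, (γ i : RatFun3) = α i - β i := fun i => by
          rw [hγ i, add_sub_cancel_right]
          rfl
        rw [hv, hv, map_sub, map_sub, hcl i j, hβ.closed i j]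
      have h1 := (ih (by omega) (fun i => (γ i : RatFun3)) (fun i => (γ i).2) hγcl).add
        (hβ.mono (Set.subset_univ _))
      rw [show α = fun i => (γ i : RatFun3) + β i from funext hγ]
      exact h1
  exact h 3 le_rfl α (fun i => by rw [firstVariables_three]; trivial) hα

/-- Sums of exact and logarithmic rational 1-forms in the form that defines Darboux functions. -/
theorem IsLogExact.exists_polynomials {α : Fin 3 → RatFun3} (h : IsLogExact Set.univ α) :
    ∃ (r : RatFun3) (N : ℕ) (p : Fin N → Poly) (a : Fin N → ℂ), (∀ k, p k ≠ 0) ∧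
      α = d r + ∑ k, a k • (algebraMap Poly RatFun3 (p k))⁻¹ • d (algebraMap Poly RatFun3 (p k)) := by
  induction h with
  | exact r _ => exact ⟨r, 0, Fin.elim0, Fin.elim0, fun k => k.elim0, by simp; rfl⟩
  | log c p hc _ _ hp0 =>
    obtain ⟨c, rfl⟩ := exists_complex_of_constant hc
    obtain ⟨u, v, hv, rfl⟩ := exists_eq_div p
    have hu : u ≠ 0 := by
      rintro rfl
      simp at hp0
    have hu' : algebraMap Poly RatFun3 u ≠ 0 := by simpa using hu
    have hv' : algebraMap Poly RatFun3 v ≠ 0 := by simpa using hv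
    -- For `p = u / v`, the logarithmic form splits as `c du/u - c dv/v`.
    refine ⟨0, 2, ![u, v], ![c, -c], fun k => by fin_cases k <;> assumption, funext fun i => ?_⟩
    simp only [Fin.sum_univ_two, Pi.add_apply, Pi.smul_apply, d, map_zero, zero_add,
      Matrix.cons_val_zero, Matrix.cons_val_one, smul_eq_mul]
    simp only [Algebra.smul_def, map_neg]
    rw [der_div _ _ hv']
    field_simp
    ring
  | add _ _ ih1 ih2 =>
    obtain ⟨r₁, N₁, p₁, a₁, hp₁, rfl⟩ := ih1
    obtain ⟨r₂, N₂, p₂, a₂, hp₂, rfl⟩ := ih2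
    refine ⟨r₁ + r₂, N₁ + N₂, Fin.append p₁ p₂, Fin.append a₁ a₂, fun k => ?_, funext fun i => ?_⟩
    · refine Fin.addCases (fun k => ?_) (fun k => ?_) k
      · rw [Fin.append_left]; exact hp₁ k
      · rw [Fin.append_right]; exact hp₂ k
    · simp only [Fin.sum_univ_add, Fin.append_left, Fin.append_right, Pi.add_apply, d, map_add]
      ring

end RationalFunctions

/-! ### Proportionality of all Darboux pairs, and the descent to rational forms. -/

section Main

/-- Lets `exists_liouvillian_integral` be applied to a pair that is already rational. -/
theorem IsLiouvillianExtension.refl (K : Type*) [Field K] [DiffField K] :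
    IsLiouvillianExtension K K where
  der_algebraMap _ _ := rfl
  constants_eq := by
    ext c
    exact ⟨fun ⟨b, hb, hbc⟩ => hbc ▸ hb, fun hc => ⟨c, hc, rfl⟩⟩
  exists_tower := ⟨0, fun _ => ⊥, rfl, Subsingleton.elim _ _, fun i hi =>
    absurd hi (Nat.not_lt_zero i)⟩

/-- If there are no two independent first integrals, all Darboux pairs over the algebraic closure
of a Liouvillian extension are proportional to the differential of a given first integral. -/
theorem wedge_d_eq_zero {Ω : Fin 3 → RatFun3}
    (htwo : ¬ HasTwoIndependentLiouvillianFirstIntegrals Ω) {L : Type} [Field L] [CharZero L]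
    [DiffField L] [Algebra RatFun3 L] (hL : IsLiouvillianExtension RatFun3 L) {φ : L}
    (hφ : IsFirstIntegral Ω φ) {ω α : Fin 3 → AlgebraicClosure L}
    (H : IsDarbouxPair (fun i => algebraMap RatFun3 (AlgebraicClosure L) (Ω i)) ω α) :
    wedge ω (d (algebraMap L (AlgebraicClosure L) φ)) = 0 := by
  have := isAlgClosed_constants_ratFun3
  obtain ⟨M, _, _, _, N, _, _, _, j, hM, hN, hj, hjK, hjL, m, ψ, hm0, hm, hψ⟩ :=
    exists_liouvillian_integral hL ω α H.der_sub H.closed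
  obtain ⟨φ', hφ'⟩ := hjL φ
  have hm0' : (j m)⁻¹ ≠ 0 := inv_ne_zero ((_root_.map_ne_zero j).mpr hm0)
  have hφd : ∀ i, j (der i φ') =
      algebraMap (AlgebraicClosure L) M (algebraMap L (AlgebraicClosure L) (der i φ)) := by
    intro i
    rw [hj, hφ', der_algebraMap, der_algebraMap]
  have hψd : ∀ i, j (der i ψ) = (j m)⁻¹ * algebraMap (AlgebraicClosure L) M (ω i) := fun i => by
    rw [hj, hψ]
  have h1 : IsFirstIntegral Ω φ' := by
    refine ⟨fun hc => hφ.1 fun i => ?_, ?_⟩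
    · have h := hφd i
      rw [hc i, map_zero] at h
      apply (algebraMap L (AlgebraicClosure L)).injective
      apply (algebraMap (AlgebraicClosure L) M).injective
      rw [← h, map_zero, map_zero]
    · apply j.injective
      have h := congrArg (algebraMap (AlgebraicClosure L) M)
        (congrArg (algebraMap L (AlgebraicClosure L)) hφ.2)
      simp only [wedgeTwo, dotProduct, d, mapForm, map_sum, map_mul, map_zero] at h ⊢
      rw [← h]
      refine Finset.sum_congr rfl fun i _ => ?_
      rw [hφd, hjK, IsScalarTower.algebraMap_apply RatFun3 L (AlgebraicClosure L)]
  have h2 : IsFirstIntegral Ω ψ := by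
    refine ⟨fun hc => H.ne_zero (funext fun i => ?_), ?_⟩
    · have h := hψd i
      rw [hc i, map_zero] at h
      apply (algebraMap (AlgebraicClosure L) M).injective
      rw [Pi.zero_apply, map_zero]
      exact (mul_eq_zero.mp h.symm).resolve_left hm0'
    · apply j.injective
      have h := congrArg (algebraMap (AlgebraicClosure L) M) H.wedgeTwo_eq
      simp only [wedgeTwo, dotProduct, d, mapForm, map_sum, map_mul, map_zero] at h ⊢
      rw [← mul_zero (j m)⁻¹, ← h, Finset.mul_sum]
      refine Finset.sum_congr rfl fun i _ => ?_
      rw [hψd, hjK, mul_assoc]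
  -- The copy `φ'` of `φ` and `ψ = ∫ω/m` are first integrals in the same Liouvillian extension `N`,
  -- so they cannot be independent.
  have h3 : wedge (d ψ) (d φ') = 0 := by
    by_contra hne
    exact htwo ⟨N, inferInstance, inferInstance, inferInstance, hN, ψ, φ', h2, h1, hne⟩
  rw [wedge_eq_zero_iff] at h3 ⊢
  intro i k
  have h := congrArg j (h3 i k)
  simp only [d, map_mul, hφd, hψd] at h
  simp only [d, der_algebraMap]
  apply (algebraMap (AlgebraicClosure L) M).injective
  rw [map_mul, map_mul]
  apply mul_left_cancel₀ hm0'
  rw [← mul_assoc, ← mul_assoc]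
  exact h

/-- The descent of a Liouvillian first integral to a Darboux pair of rational 1-forms. -/
theorem exists_isDarbouxPair_ratFun3 {Ω : Fin 3 → RatFun3}
    (hone : HasLiouvillianFirstIntegral Ω)
    (htwo : ¬ HasTwoIndependentLiouvillianFirstIntegrals Ω) :
    ∃ ω α : Fin 3 → RatFun3, IsDarbouxPair Ω ω α := by
  obtain ⟨L, _, _, _, hL, φ, hφ⟩ := hone
  have : IsDiffExtension RatFun3 L := hL.toIsDiffExtension
  have : CharZero L := charZero_of_injective_algebraMap (algebraMap RatFun3 L).injective
  have hφ0 : d φ ≠ 0 := fun h => hφ.1 fun i => congrFun h i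
  have hφ0' : d (algebraMap L (AlgebraicClosure L) φ) ≠ 0 := fun h => hφ.1 fun i => by
    have hi := congrFun h i
    simp only [d, der_algebraMap, Pi.zero_apply] at hi
    exact (_root_.map_eq_zero _).mp hi
  -- The descent starts from the pair `(dφ, 0)` over the top of the tower.
  refine IsReachable.exists_isDarbouxPair (M := AlgebraicClosure L) ?_ hL.isReachable_top
    (ω := d φ) (α := 0) (fun _ => trivial) (fun _ => trivial)
    ⟨hφ0, hφ.2, fun i j => by simp [d, der_comm i j], fun i j => by simp⟩
  intro ω₁ α₁ ω₂ α₂ H₁ H₂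
  obtain ⟨c₁, hc₁⟩ := exists_smul_eq_of_wedge_eq_zero hφ0' (wedge_d_eq_zero htwo hL hφ H₁)
  obtain ⟨c₂, hc₂⟩ := exists_smul_eq_of_wedge_eq_zero hφ0' (wedge_d_eq_zero htwo hL hφ H₂)
  rw [wedge_eq_zero_iff, hc₁, hc₂]
  intro i j
  simp only [Pi.smul_apply, smul_eq_mul]
  ring

end Main

end Liouvillian

end

theorem corollary3p5 (P Q R : Liouvillian.RatFun3)
    (hone : Liouvillian.HasLiouvillianFirstIntegral ![P, Q, R])
    (htwo : ¬ Liouvillian.HasTwoIndependentLiouvillianFirstIntegrals ![P, Q, R]) :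
    ∃ ω α : Liouvillian.OneForm Liouvillian.RatFun3,
      ω ≠ 0 ∧
      Liouvillian.wedgeTwo ω ![P, Q, R] = 0 ∧
      Liouvillian.wedge α ω = Liouvillian.dOne ω ∧
      Liouvillian.dOne α = 0 ∧
      ∃ (L : Type) (_ : Field L) (_ : Liouvillian.DiffField L) (_ : Algebra Liouvillian.RatFun3 L),
        Liouvillian.IsLiouvillianExtension Liouvillian.RatFun3 L ∧
        ∃ m φ : L,
          Liouvillian.IsDarbouxFunction m ∧
          Liouvillian.d m = m • Liouvillian.mapForm L α ∧
          Liouvillian.d φ = m⁻¹ • Liouvillian.mapForm L ω ∧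
          Liouvillian.IsFirstIntegral ![P, Q, R] φ := by
  open Liouvillian DiffField in
  have := isAlgClosed_constants_ratFun3
  obtain ⟨ω, α, H⟩ := exists_isDarbouxPair_ratFun3 hone htwo
  -- The integration theorem takes forms over the algebraic closure; `j` is injective and identifies
  -- the images of rational functions, so the resulting equations can be read back in `N`.
  have HA := H.map (algebraMap RatFun3 (AlgebraicClosure RatFun3))
    fun i x => (der_algebraMap i x).symm
  obtain ⟨M, _, _, _, N, _, _, _, j, hM, hN, hj, hjK, -, m, φ, hm0, hm, hφ⟩ :=
    exists_liouvillian_integral (IsLiouvillianExtension.refl RatFun3) _ _ HA.der_sub HA.closed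
  have hdm : d m = m • mapForm N α := by
    funext i
    apply j.injective
    rw [Pi.smul_apply, smul_eq_mul, map_mul, mapForm, hjK]
    exact (hj i m).trans ((hm i).trans (mul_comm _ _))
  have hdφ : d φ = m⁻¹ • mapForm N ω := by
    funext i
    apply j.injective
    rw [Pi.smul_apply, smul_eq_mul, map_mul, map_inv₀, mapForm, hjK]
    exact (hj i φ).trans (hφ i)
  obtain ⟨r, n, p, a, hp, hα⟩ := (isLogExact_of_closed H.closed).exists_polynomials
  obtain ⟨g, f, hf, rfl⟩ := exists_eq_div r
  refine ⟨ω, α, H.ne_zero, H.wedgeTwo_eq, ((dOne_eq_wedge_iff ω α ω).mpr H.der_sub).symm,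
    (dOne_eq_zero_iff α).mpr H.closed, N, inferInstance, inferInstance, inferInstance, hN, m, φ,
    ⟨hm0, g, f, n, p, a, hf, hp, by rw [← hα, hdm]⟩, hdm, hdφ, fun hc => ?_, ?_⟩
  · apply H.ne_zero
    funext i
    have h := congrFun hdφ i
    rw [show d φ i = 0 from hc i, Pi.smul_apply, smul_eq_mul, eq_comm, mul_eq_zero] at h
    exact (_root_.map_eq_zero _).mp (h.resolve_left (inv_ne_zero hm0))
  · rw [hdφ, wedgeTwo_smul]
    have h := congrArg (algebraMap RatFun3 N) H.wedgeTwo_eq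
    simp only [wedgeTwo, dotProduct, mapForm, map_sum, map_mul, map_zero] at h ⊢
    rw [h, mul_zero]
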